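/- **Definitions.** A vector space with specified state vector is a triple $(\mathcal X,\mathring{\mathcal X},\xi)$ with $\mathcal X=\mathbb C\xi\oplus\mathring{\mathcal X}$, $\xi\ne0$. The free product of a family $(\mathcal X_t,\mathring{\mathcal X}_t,\xi_t)_{t\in T}$ is $\mathcal X=\mathbb C\xi\oplus\bigoplus_{n\ge1}\bigoplus_{t_1\ne t_2\ne\cdots\ne t_n}\mathring{\mathcal X}_{t_1}\otimes\cdots\otimes\mathring{\mathcal X}_{t_n}$. Let $\mathcal X(l,t)$ (resp. $\mathcal X(r,t)$) be the sum of $\mathbb C\xi$ and the summands with $t_1\neq t$ (resp. $t_n\ne t$). With the natural identifications $V_t:\mathcal X_t\otimes\mathcal X(l,t)\to\mathcal X$ and $W_t:\mathcal X(r,t)\otimes\mathcal X_t\to\mathcal X$ put $\lambda_t(S)=V_t(S\otimes I)V_t^{-1}$ and $\rho_t(S)=W_t(I\otimes S)W_t^{-1}$ for linear operators $S$ on $\mathcal X_t$. The linear operators on $\mathcal X$ carry the functional $S\mapsto$ the coefficient of $\xi$ in $S\xi$. Let $I,J$ be sets (left and right indices). Two-faced families $z^{t}=((z^t_i)_{i\in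 I},(z^t_j)_{j\in J})$, $t\in T$, in a complex unital algebra $\mathcal A$ with a linear functional $\varphi$, $\varphi(1)=1$, are *bi-free* if there are spaces $(\mathcal X_t,\mathring{\mathcal X}_t,\xi_t)$ and operators $S^t_k$ on $\mathcal X_t$, $k\in I\sqcup J$, such that the family of all $z^t_k$ has the same joint moments as the family of the operators $\lambda_t(S^t_i)$, $i\in I$, and $\rho_t(S^t_j)$, $j\in J$, on the free product. For a word $\alpha=k_1\cdots k_n$ in $I\sqcup J$, $n\ge1$, the *bi-free cumulant* $R_\alpha$ is the unique polynomial with complex coefficients of the form $R_\alpha=X_\alpha+\tilde R_\alpha$, where $\tilde R_\alpha$ is a polynomial in variables $X_\beta$, $\beta$ running over the words obtained by restricting $\alpha$ to nonempty proper subsets of the positions, such that $R_\alpha$ is homogeneous of degree $n$ when $X_\beta$ has the length of $\beta$ as its degree, and such that $R_\alpha(z'+z'')=R_\alpha(z')+R_\alpha(z'')$ for every bi-free pair $z',z''$. Here $R_\alpha(z)$ is the value of $R_\alpha$ when every $X_\beta$, $\beta=b_1\cdots b_m$, is replaced by the moment $\varphi(z_{b_1}\cdots z_{b_m})$. A linear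 functional $\mu$ on $\mathbb C\langle Z_k\mid k\in I\sqcup J\rangle$ with $\mu(1)=1$ is a *bi-free central limit distribution* if $R_\alpha(\mu)=0$ for all words $\alpha$ of length $1$ and of length at least $3$. On $\mathbb C\langle Z_k,Z_k^*\mid k\in K\rangle$, $K=I\sqcup J$, where $Z_i,Z_i^*$ ($i\in I$) are left and $Z_j,Z_j^*$ ($j\in J$) are right variables, use the conjugate-linear involution which reverses products and exchanges $Z_k$ and $Z_k^*$. A *bi-free central limit $*$-distribution* is a bi-free central limit distribution $\varphi$ for $((Z_i,Z_i^*)_{i\in I},(Z_j,Z_j^*)_{j\in J})$ with $\varphi(P^*P)\ge0$ for all $P$. For a complex Hilbert space $\mathcal H$, let $\mathcal T(\mathcal H)=\mathbb C1\oplus\bigoplus_{n\ge1}\mathcal H^{\otimes n}$ be the full Fock space, and let $l(h)\zeta=h\otimes\zeta$, $r(h)\zeta=\zeta\otimes h$, $l(h)1=r(h)1=h$, $l^*(h)=l(h)^*$, $r^*(h)=r(h)^*$. Scalar products are linear in the first variable. **Theorem.** (1) A bi-free central limit distribution $\varphi:\mathbb C\langle Z_k,Z_k^*\mid k\in K\rangle\to\mathbb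 C$ is a bi-free central limit $*$-distribution if and only if the matrix of second order moments $$C=\begin{pmatrix}(\varphi(Z_k^*Z_l))_{k,l\in K}&(\varphi(Z_k^*Z_l^*))_{k,l\in K}\\(\varphi(Z_kZ_l))_{k,l\in K}&(\varphi(Z_kZ_l^*))_{k,l\in K}\end{pmatrix}$$ is positive semidefinite (for infinite $K$: Hermitian, with nonnegative quadratic form on finitely supported vectors). (2) Suppose that $I$ and $J$ are finite, and let $h(k),h^*(k)$, $k\in K$, be vectors in a complex Hilbert space $\mathcal H$. Then the $*$-distribution, with respect to the vacuum vector $1\in\mathcal T(\mathcal H)$, of the two-faced family $z_i=l(h(i))+l^*(h^*(i))$, $i\in I$, and $z_j=r(h(j))+r^*(h^*(j))$, $j\in J$, is a bi-free central limit $*$-distribution, its matrix of second order moments is $$C=\begin{pmatrix}(\langle h(l),h(k)\rangle)_{k,l\in K}&(\langle h^*(l),h(k)\rangle)_{k,l\in K}\\(\langle h(l),h^*(k)\rangle)_{k,l\in K}&(\langle h^*(l),h^*(k)\rangle)_{k,l\in K}\end{pmatrix},$$ and it is the only bi-free central limit distribution on $\mathbb C\langle Z_k,Z_k^*\mid k\in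 K\rangle$ with this matrix of second order moments. -/

import Mathlib

open scoped TensorProduct ComplexOrder

universe u v w

noncomputable section

namespace BiFree

/-! ### Distributions -/

/-- The distribution of a family `z` of elements of the algebra `A` with respect to the
functional `φ`: the functional `P ↦ φ (P(z))` on the noncommutative polynomials
`ℂ⟨Z_k | k ∈ L⟩`. -/
def distribution {L : Type*} {A : Type*} [Ring A] [Algebra ℂ A] (φ : A →ₗ[ℂ] ℂ) (z : L → A) :
    FreeAlgebra ℂ L →ₗ[ℂ] ℂ :=
  φ ∘ₗ (FreeAlgebra.lift ℂ z).toLinearMap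

/-- The noncommutative monomial `Z_{k₁} ⋯ Z_{kₙ}` of the word `k₁ ⋯ kₙ`. -/
def monomial {L : Type*} (m : List L) : FreeAlgebra ℂ L :=
  (m.map (FreeAlgebra.ι ℂ)).prod

/-- The moment `μ(Z_{k₁} ⋯ Z_{kₙ})`. -/
def moment {L : Type*} (μ : FreeAlgebra ℂ L →ₗ[ℂ] ℂ) (m : List L) : ℂ :=
  μ (monomial m)

/-! ### Free products of vector spaces with specified state vector

A vector space with specified state vector is a triple `(X, X°, ξ)` with `X = ℂ ξ ⊕ X°`.
Choosing a basis `B` of `X°` one gets `X = (Option B →₀ ℂ)`, where the basis vector `none` is `ξ`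
and the basis vectors `some b` span `X°`; every vector space with specified state vector is of
this form.  In these coordinates the tensor products `X°_{k₁} ⊗ ⋯ ⊗ X°_{kₙ}`, `k₁ ≠ k₂ ≠ ⋯ ≠ kₙ`,
have as bases the words `b₁ ⋯ bₙ` with `b_j ∈ B_{k_j}`. -/

section FreeProduct

variable {T : Type v} (B : T → Type u)

/-- Alternating words: the basis of the free product of the spaces `ℂ ξ_k ⊕ X°_k`.  The empty
word is the state vector `ξ`. -/
def AltWord : Type (max u v) :=
  {m : List (Σ k, B k) // m.IsChain fun a b => a.1 ≠ b.1}

/-- The empty word. -/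
def AltWord.nil : AltWord B := ⟨[], List.isChain_nil⟩

/-- The basis of `X(l,k)`: alternating words which do not begin with a letter of `B k`. -/
def LeftTail (k : T) : Type (max u v) :=
  {m : AltWord B // ∀ a ∈ m.1.head?, a.1 ≠ k}

/-- The basis of `X(r,k)`: alternating words which do not end with a letter of `B k`. -/
def RightTail (k : T) : Type (max u v) :=
  {m : AltWord B // ∀ a ∈ m.1.getLast?, a.1 ≠ k}

variable {B}

/-- `ξ_k ⊗ m ↦ m` and `b ⊗ m ↦ b m`. -/
def leftGlue (k : T) : Option (B k) × LeftTail B k → AltWord B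
  | (none, m) => m.1
  | (some b, m) => ⟨⟨k, b⟩ :: m.1.1,
      List.isChain_cons.2 ⟨fun a ha => (m.2 a ha).symm, m.1.2⟩⟩

/-- `m ⊗ ξ_k ↦ m` and `m ⊗ b ↦ m b`. -/
def rightGlue (k : T) : RightTail B k × Option (B k) → AltWord B
  | (m, none) => m.1
  | (m, some b) => ⟨m.1.1 ++ [⟨k, b⟩],
      List.isChain_append.2 ⟨m.1.2, List.isChain_singleton _, fun a ha b' hb' => by
        simp only [List.head?_cons, Option.mem_def, Option.some.injEq] at hb'
        subst hb'
        exact m.2 a ha⟩⟩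

theorem leftGlue_bijective (k : T) : Function.Bijective (leftGlue (B := B) k) := by
  constructor
  · rintro ⟨x, m⟩ ⟨y, n⟩ h
    have h' := congrArg Subtype.val h
    rcases x with _ | x <;> rcases y with _ | y <;> simp only [leftGlue] at h'
    · have : m = n := Subtype.ext (Subtype.ext h')
      rw [this]
    · exact absurd rfl (m.2 ⟨k, y⟩ (by rw [h']; rfl))
    · exact absurd rfl (n.2 ⟨k, x⟩ (by rw [← h']; rfl))
    · simp only [List.cons.injEq, Sigma.mk.injEq, heq_eq_eq, true_and] at h'
      have : m = n := Subtype.ext (Subtype.ext h'.2)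
      rw [this, h'.1]
  · rintro ⟨m, hm⟩
    rcases m with _ | ⟨⟨j, b⟩, t⟩
    · exact ⟨(none, ⟨AltWord.nil B, by simp [AltWord.nil]⟩), rfl⟩
    · by_cases hj : j = k
      · subst hj
        rw [List.isChain_cons] at hm
        exact ⟨(some b, ⟨⟨t, hm.2⟩, fun a ha => (hm.1 a ha).symm⟩), rfl⟩
      · exact ⟨(none, ⟨⟨_, hm⟩, by simpa using hj⟩), rfl⟩

theorem rightGlue_bijective (k : T) : Function.Bijective (rightGlue (B := B) k) := by
  constructor
  · rintro ⟨m, x⟩ ⟨n, y⟩ h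
    have h' := congrArg Subtype.val h
    rcases x with _ | x <;> rcases y with _ | y <;> simp only [rightGlue] at h'
    · have : m = n := Subtype.ext (Subtype.ext h')
      rw [this]
    · exact absurd rfl (m.2 ⟨k, y⟩ (by rw [h']; simp))
    · exact absurd rfl (n.2 ⟨k, x⟩ (by rw [← h']; simp))
    · have h2 := List.append_inj' h' rfl
      simp only [List.cons.injEq, Sigma.mk.injEq, heq_eq_eq, true_and, and_true] at h2
      have : m = n := Subtype.ext (Subtype.ext h2.1)
      rw [this, h2.2]
  · rintro ⟨m, hm⟩
    rcases List.eq_nil_or_concat m with rfl | ⟨t, ⟨j, b⟩, rfl⟩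
    · exact ⟨(⟨AltWord.nil B, by simp [AltWord.nil]⟩, none), rfl⟩
    · rw [List.concat_eq_append] at hm
      by_cases hj : j = k
      · subst hj
        have h2 := List.isChain_append.1 hm
        exact ⟨(⟨⟨t, h2.1⟩, fun a ha => h2.2.2 a ha _ rfl⟩, some b),
          Subtype.ext List.concat_eq_append.symm⟩
      · exact ⟨(⟨⟨_, hm⟩, by simpa using hj⟩, none), Subtype.ext List.concat_eq_append.symm⟩

/-- The identification `V_k : X_k ⊗ X(l,k) → X`. -/
def leftIso (k : T) :
    (Option (B k) →₀ ℂ) ⊗[ℂ] (LeftTail B k →₀ ℂ) ≃ₗ[ℂ] (AltWord B →₀ ℂ) :=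
  finsuppTensorFinsupp' ℂ (Option (B k)) (LeftTail B k) ≪≫ₗ
    Finsupp.domLCongr (Equiv.ofBijective _ (leftGlue_bijective k))

/-- The identification `W_k : X(r,k) ⊗ X_k → X`. -/
def rightIso (k : T) :
    (RightTail B k →₀ ℂ) ⊗[ℂ] (Option (B k) →₀ ℂ) ≃ₗ[ℂ] (AltWord B →₀ ℂ) :=
  finsuppTensorFinsupp' ℂ (RightTail B k) (Option (B k)) ≪≫ₗ
    Finsupp.domLCongr (Equiv.ofBijective _ (rightGlue_bijective k))

/-- The left operator `λ_k(S) = V_k (S ⊗ I) V_k⁻¹` on the free product. -/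
def leftOp (k : T) (S : Module.End ℂ (Option (B k) →₀ ℂ)) : Module.End ℂ (AltWord B →₀ ℂ) :=
  (leftIso k).toLinearMap ∘ₗ LinearMap.rTensor (LeftTail B k →₀ ℂ) S ∘ₗ
    (leftIso k).symm.toLinearMap

/-- The right operator `ρ_k(S) = W_k (I ⊗ S) W_k⁻¹` on the free product. -/
def rightOp (k : T) (S : Module.End ℂ (Option (B k) →₀ ℂ)) : Module.End ℂ (AltWord B →₀ ℂ) :=
  (rightIso k).toLinearMap ∘ₗ LinearMap.lTensor (RightTail B k →₀ ℂ) S ∘ₗ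
    (rightIso k).symm.toLinearMap

variable (B) in
/-- The expectation functional of the free product: the coefficient of `ξ` in `S ξ`. -/
def freeProductState : Module.End ℂ (AltWord B →₀ ℂ) →ₗ[ℂ] ℂ :=
  Finsupp.lapply (AltWord.nil B) ∘ₗ LinearMap.applyₗ (Finsupp.single (AltWord.nil B) 1)

end FreeProduct

/-! ### Bi-freeness -/

/-- Bi-freeness of a family, indexed by `T`, of two-faced families
`((z t (inl i))_{i ∈ I}, (z t (inr j))_{j ∈ J})` in `(A, φ)`: for suitable vector spaces with
specified state vector and operators `S t k` on them, the joint distribution is that of the left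
operators of the `S t (inl i)` and the right operators of the `S t (inr j)` on the free product. -/
def IsBiFree {T : Type v} {I J : Type u} {A : Type w} [Ring A] [Algebra ℂ A] (φ : A →ₗ[ℂ] ℂ)
    (z : T → I ⊕ J → A) : Prop :=
  ∃ (B : T → Type u) (S : ∀ t, I ⊕ J → Module.End ℂ (Option (B t) →₀ ℂ)),
    distribution φ (fun p : T × (I ⊕ J) => z p.1 p.2) =
      distribution (freeProductState B) (fun p : T × (I ⊕ J) =>
        match p.2 with
        | Sum.inl i => leftOp p.1 (S p.1 (Sum.inl i))
        | Sum.inr j => rightOp p.1 (S p.1 (Sum.inr j)))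

/-! ### Bi-free cumulants and central limit distributions -/

/-- The characterization of the bi-free cumulant polynomial of the word `m = k₁ ⋯ kₙ`.  The
variables are indexed by words: the variable `u` stands for the moment of the word `u`. -/
structure IsCumulantPolynomial {I J : Type u} (m : List (I ⊕ J))
    (R : MvPolynomial (List (I ⊕ J)) ℂ) : Prop where
  /-- `R` is the variable of the full word plus a polynomial in the variables of the words
  obtained by restricting `m` to nonempty proper sets of positions. -/
  leading : ∃ R' : MvPolynomial (List (I ⊕ J)) ℂ, R = MvPolynomial.X m + R' ∧
    ∀ x ∈ R'.vars, x ≠ [] ∧ x.Sublist m ∧ x.length < m.length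
  /-- `R` is homogeneous of degree `n` if the variable of a word has the length of the word as
  its degree. -/
  homogeneous : MvPolynomial.IsWeightedHomogeneous List.length R m.length
  /-- `R` is additive on bi-free pairs of two-faced families. -/
  additive : ∀ (A : Type u) [Ring A] [Algebra ℂ A] (φ : A →ₗ[ℂ] ℂ) (z : Bool → I ⊕ J → A),
    φ 1 = 1 → IsBiFree φ z →
      MvPolynomial.eval (moment (distribution φ (z false))) R +
          MvPolynomial.eval (moment (distribution φ (z true))) R =
        MvPolynomial.eval (moment (distribution φ fun k => z false k + z true k)) R

/-- The bi-free cumulant polynomial `R_{k₁ ⋯ kₙ}`: the polynomial with the characterizing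
properties (for every nonempty word there is exactly one). -/
def cumulantPolynomial {I J : Type u} (m : List (I ⊕ J)) : MvPolynomial (List (I ⊕ J)) ℂ :=
  Classical.epsilon (IsCumulantPolynomial m)

/-- The bi-free cumulant `R_{k₁ ⋯ kₙ}(μ)`. -/
def cumulant {I J : Type u} (μ : FreeAlgebra ℂ (I ⊕ J) →ₗ[ℂ] ℂ) (m : List (I ⊕ J)) : ℂ :=
  MvPolynomial.eval (moment μ) (cumulantPolynomial m)

/-- `μ` is a bi-free central limit distribution with left indices `I` and right indices `J`:
a unital functional whose cumulants of order `1` and of order at least `3` vanish. -/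
def IsCentralLimit {I J : Type u} (μ : FreeAlgebra ℂ (I ⊕ J) →ₗ[ℂ] ℂ) : Prop :=
  μ 1 = 1 ∧ ∀ m : List (I ⊕ J), m.length = 1 ∨ 3 ≤ m.length → cumulant μ m = 0

/-! ### Polynomials in `Z_k` and `Z_k^*`

The left indices of the family `((Z_i, Z_i^*)_{i ∈ I}, (Z_j, Z_j^*)_{j ∈ J})` are `I ⊕ I` and the
right indices are `J ⊕ J`; the second summands stand for the adjoint variables. -/

/-- The letters `Z_k, Z_k^*`, `k ∈ I ⊕ J`, arranged as a two-faced index set. -/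
abbrev StarIndex (I J : Type u) : Type u := (I ⊕ I) ⊕ (J ⊕ J)

/-- The algebra `ℂ⟨Z_k, Z_k^* | k ∈ I ⊕ J⟩`. -/
abbrev StarPoly (I J : Type u) : Type u := FreeAlgebra ℂ (StarIndex I J)

section StarPoly

variable {I J : Type u}

/-- The letter of `Z_k`. -/
def plain : I ⊕ J → StarIndex I J := Sum.map Sum.inl Sum.inl

/-- The letter of `Z_k^*`. -/
def starred : I ⊕ J → StarIndex I J := Sum.map Sum.inr Sum.inr

/-- The exchange of `Z_k` and `Z_k^*`. -/
def swapStar : StarIndex I J → StarIndex I J := Sum.map Sum.swap Sum.swap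

/-- The variable `Z_k`. -/
def Z (k : I ⊕ J) : StarPoly I J := FreeAlgebra.ι ℂ (plain k)

/-- The variable `Z_k^*`. -/
def Zs (k : I ⊕ J) : StarPoly I J := FreeAlgebra.ι ℂ (starred k)

/-- The conjugate-linear anti-multiplicative involution `P ↦ P^*` which exchanges `Z_k` and
`Z_k^*`: coefficients are conjugated, monomials are reversed and their letters exchanged.
(Mathlib's `star` on a free algebra is linear and fixes the variables.) -/
def adjointPoly (P : StarPoly I J) : StarPoly I J :=
  (FreeAlgebra.equivMonoidAlgebraFreeMonoid P).coeff.sum fun m c =>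
    (starRingEnd ℂ c) • monomial (m.toList.reverse.map swapStar)

/-- A bi-free central limit `*`-distribution: a bi-free central limit distribution which is
positive, `φ(P^* P) ≥ 0` for all `P` (the order of `ℂ`: real and nonnegative). -/
def IsCentralLimitStar (φ : StarPoly I J →ₗ[ℂ] ℂ) : Prop :=
  IsCentralLimit φ ∧ ∀ P : StarPoly I J, 0 ≤ φ (adjointPoly P * P)

/-- The matrix of second order moments, in which the entry of the letters `a`, `b` is
`φ(a^* b)`. -/
def secondMoments (φ : StarPoly I J →ₗ[ℂ] ℂ) :
    Matrix ((I ⊕ J) ⊕ (I ⊕ J)) ((I ⊕ J) ⊕ (I ⊕ J)) ℂ :=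
  Matrix.fromBlocks
    (Matrix.of fun k l => φ (Zs k * Z l)) (Matrix.of fun k l => φ (Zs k * Zs l))
    (Matrix.of fun k l => φ (Z k * Z l)) (Matrix.of fun k l => φ (Z k * Zs l))

/-- The `*`-distribution of the family `z` in the `*`-algebra `A` with respect to `φ`. -/
def starDistribution {A : Type*} [Ring A] [Algebra ℂ A] [Star A] (φ : A →ₗ[ℂ] ℂ)
    (z : I ⊕ J → A) : StarPoly I J →ₗ[ℂ] ℂ :=
  distribution φ (Sum.elim
    (Sum.elim (fun i => z (Sum.inl i)) fun i => star (z (Sum.inl i)))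
    (Sum.elim (fun j => z (Sum.inr j)) fun j => star (z (Sum.inr j))))

end StarPoly

/-! ### The full Fock space

`𝒯(H)` is the Hilbert space direct sum of the completed tensor powers of `H`, starting with the
one-dimensional space spanned by the vacuum vector. -/

/-- A complex inner product space. -/
structure InnerSpace : Type (w + 1) where
  /-- The underlying type. -/
  carrier : Type w
  [group : NormedAddCommGroup carrier]
  [inner : InnerProductSpace ℂ carrier]

attribute [instance] InnerSpace.group InnerSpace.inner

section Shift

theorem norm_completion_apply_le {E F : Type w} [NormedAddCommGroup E] [InnerProductSpace ℂ E]
    [NormedAddCommGroup F] [InnerProductSpace ℂ F] (f : E →L[ℂ] F)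
    (x : UniformSpace.Completion E) : ‖f.completion x‖ ≤ ‖f‖ * ‖x‖ := by
  induction x using UniformSpace.Completion.induction_on with
  | hp => exact isClosed_le (by fun_prop) (by fun_prop)
  | ih a =>
    rw [ContinuousLinearMap.completion_apply_coe, UniformSpace.Completion.norm_coe,
      UniformSpace.Completion.norm_coe]
    exact f.le_opNorm a

/-- The sequence `0, f 0 (ζ 0), f 1 (ζ 1), …`. -/
def shiftSeq {E : ℕ → Type w} [∀ n, NormedAddCommGroup (E n)] [∀ n, InnerProductSpace ℂ (E n)]
    (f : ∀ n, E n →L[ℂ] E (n + 1)) (ζ : lp E 2) : PreLp E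
  | 0 => 0
  | n + 1 => f n (ζ n)

theorem summable_shiftSeq {E : ℕ → Type w} [∀ n, NormedAddCommGroup (E n)]
    [∀ n, InnerProductSpace ℂ (E n)] (f : ∀ n, E n →L[ℂ] E (n + 1)) (C : ℝ)
    (hf : ∀ n x, ‖f n x‖ ≤ C * ‖x‖) (ζ : lp E 2) :
    Summable (fun n => ‖shiftSeq f ζ n‖ ^ (2 : ℝ)) ∧
      ∑' n, ‖shiftSeq f ζ n‖ ^ (2 : ℝ) ≤ C ^ (2 : ℝ) * ‖ζ‖ ^ (2 : ℝ) := by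
  have h0 := lp.hasSum_norm (p := 2) (by norm_num) ζ
  rw [ENNReal.toReal_ofNat] at h0
  have h1 := h0.mul_left (C ^ (2 : ℝ))
  have hle : ∀ n, ‖shiftSeq f ζ (n + 1)‖ ^ (2 : ℝ) ≤ C ^ (2 : ℝ) * ‖ζ n‖ ^ (2 : ℝ) := fun n => by
    have := pow_le_pow_left₀ (norm_nonneg _) (hf n (ζ n)) 2
    rw [mul_pow] at this
    simp only [Real.rpow_two]
    exact this
  have hs : Summable fun n => ‖shiftSeq f ζ (n + 1)‖ ^ (2 : ℝ) :=
    Summable.of_nonneg_of_le (fun n => by positivity) hle h1.summable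
  have hs' : Summable (fun n => ‖shiftSeq f ζ n‖ ^ (2 : ℝ)) := (summable_nat_add_iff 1).1 hs
  refine ⟨hs', ?_⟩
  rw [hs'.tsum_eq_zero_add]
  have : ‖shiftSeq f ζ 0‖ ^ (2 : ℝ) = 0 := by simp [shiftSeq]
  rw [this, zero_add, ← h1.tsum_eq]
  exact hs.tsum_le_tsum hle h1.summable

/-- The bounded operator on a Hilbert space direct sum which maps the summand `n` to the summand
`n + 1` by `f n`, the norms of the `f n` being bounded by `C`. -/
def shiftOp {E : ℕ → Type w} [∀ n, NormedAddCommGroup (E n)] [∀ n, InnerProductSpace ℂ (E n)]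
    (f : ∀ n, E n →L[ℂ] E (n + 1)) (C : ℝ) (hC : 0 ≤ C) (hf : ∀ n x, ‖f n x‖ ≤ C * ‖x‖) :
    lp E 2 →L[ℂ] lp E 2 :=
  LinearMap.mkContinuous
    { toFun := fun ζ => ⟨shiftSeq f ζ, memℓp_gen (by
        rw [ENNReal.toReal_ofNat]
        exact (summable_shiftSeq f C hf ζ).1)⟩
      map_add' := fun ζ η => by
        ext n
        cases n <;> simp [shiftSeq]
      map_smul' := fun c ζ => by
        ext n
        rcases n with _ | n
        · exact (smul_zero c).symm
        · exact (f n).map_smul c (ζ n) }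
    C fun ζ => by
      refine lp.norm_le_of_tsum_le (by norm_num) (by positivity) ?_
      have h := (summable_shiftSeq f C hf ζ).2
      rw [← Real.mul_rpow hC (norm_nonneg _)] at h
      simp only [ENNReal.toReal_ofNat]
      exact h

end Shift

section Fock

variable (H : Type w) [NormedAddCommGroup H] [InnerProductSpace ℂ H]

/-- The algebraic tensor power `H ⊗ (H ⊗ ⋯)` with its inner product; the power `0` is a copy of
`ℂ`. -/
def tensorPower : ℕ → InnerSpace.{w}
  | 0 => ⟨EuclideanSpace ℂ PUnit.{w + 1}⟩
  | n + 1 => ⟨H ⊗[ℂ] (tensorPower n).carrier⟩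

/-- The Hilbert space tensor power `H^{⊗ n}`. -/
abbrev HilbertPower (n : ℕ) : Type w :=
  UniformSpace.Completion (tensorPower H n).carrier

/-- The full Fock space `𝒯(H)`. -/
abbrev Fock : Type w := lp (HilbertPower H) 2

/-- The unit vector spanning the tensor power `0`. -/
def unitVector : (tensorPower H 0).carrier :=
  (EuclideanSpace.single PUnit.unit 1 : EuclideanSpace ℂ PUnit.{w + 1})

/-- The vacuum vector `1`. -/
def vacuum : Fock H :=
  lp.single 2 0 (unitVector H : HilbertPower H 0)

/-- The vacuum state `S ↦ ⟨S 1, 1⟩`. -/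
def vacuumState : (Fock H →L[ℂ] Fock H) →ₗ[ℂ] ℂ where
  toFun S := inner ℂ (vacuum H) (S (vacuum H))
  map_add' _ _ := inner_add_right _ _ _
  map_smul' _ _ := inner_smul_right _ _ _

variable {H}

/-- `ζ ↦ h ⊗ ζ` on the tensor powers. -/
def leftTensor (h : H) (n : ℕ) :
    (tensorPower H n).carrier →L[ℂ] (tensorPower H (n + 1)).carrier :=
  TensorProduct.mkL ℂ H (tensorPower H n).carrier h

/-- `ζ ↦ ζ ⊗ h` on the tensor powers: on the power `0` it is `1 ↦ h`, and on the higher ones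
`x ⊗ ζ ↦ x ⊗ (ζ ⊗ h)`. -/
def rightTensor (h : H) : (n : ℕ) →
    (tensorPower H n).carrier →L[ℂ] (tensorPower H (n + 1)).carrier
  | 0 => leftTensor h 0
  | n + 1 => ContinuousLinearMap.lTensor H (rightTensor h n)

theorem norm_leftTensor_le (h : H) (n : ℕ) : ‖leftTensor h n‖ ≤ ‖h‖ :=
  ContinuousLinearMap.opNorm_le_bound _ (norm_nonneg _) fun x =>
    (TensorProduct.norm_tmul h x).le

theorem norm_rightTensor_le (h : H) (n : ℕ) : ‖rightTensor h n‖ ≤ ‖h‖ := by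
  induction n with
  | zero => exact norm_leftTensor_le h 0
  | succ n ih => exact (ContinuousLinearMap.norm_lTensor_le H _).trans ih

/-- The left creation operator `l(h) ζ = h ⊗ ζ`, `l(h) 1 = h`. -/
def leftCreation (h : H) : Fock H →L[ℂ] Fock H :=
  shiftOp (fun n => (leftTensor h n).completion) ‖h‖ (norm_nonneg h) fun n x =>
    (norm_completion_apply_le _ x).trans
      (mul_le_mul_of_nonneg_right (norm_leftTensor_le h n) (norm_nonneg x))

/-- The right creation operator `r(h) ζ = ζ ⊗ h`, `r(h) 1 = h`. -/
def rightCreation (h : H) : Fock H →L[ℂ] Fock H :=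
  shiftOp (fun n => (rightTensor h n).completion) ‖h‖ (norm_nonneg h) fun n x =>
    (norm_completion_apply_le _ x).trans
      (mul_le_mul_of_nonneg_right (norm_rightTensor_le h n) (norm_nonneg x))

/-- The two-faced family `z_i = l(h(i)) + l(h^*(i))^*` for `i ∈ I` and
`z_j = r(h(j)) + r(h^*(j))^*` for `j ∈ J`; the vectors `h^*(k)` are `hs k`. -/
def fockFamily {I J : Type u} (h hs : I ⊕ J → H) : I ⊕ J → (Fock H →L[ℂ] Fock H)
  | Sum.inl i => leftCreation (h (Sum.inl i)) +
      ContinuousLinearMap.adjoint (leftCreation (hs (Sum.inl i)))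
  | Sum.inr j => rightCreation (h (Sum.inr j)) +
      ContinuousLinearMap.adjoint (rightCreation (hs (Sum.inr j)))

/-- The `*`-distribution of the family `fockFamily h hs` with respect to the vacuum vector. -/
def fockDistribution {I J : Type u} (h hs : I ⊕ J → H) : StarPoly I J →ₗ[ℂ] ℂ :=
  starDistribution (vacuumState H) (fockFamily h hs)

/-- The Gram matrix of the vectors `h(k)`, `h^*(k)`, in blocks.  (Mathlib's `inner ℂ x y` is
linear in `y`, so that it is `⟨y, x⟩` if the scalar product is linear in the first variable.) -/
def gramBlocks {I J : Type u} (h hs : I ⊕ J → H) :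
    Matrix ((I ⊕ J) ⊕ (I ⊕ J)) ((I ⊕ J) ⊕ (I ⊕ J)) ℂ :=
  Matrix.fromBlocks
    (Matrix.of fun k l => inner ℂ (h k) (h l)) (Matrix.of fun k l => inner ℂ (h k) (hs l))
    (Matrix.of fun k l => inner ℂ (hs k) (h l)) (Matrix.of fun k l => inner ℂ (hs k) (hs l))

end Fock

end BiFree

end

/-! Everything rests on one recursion. A word records letters in the order in which their operators
have acted; left letters enter a queue at the front, right letters at the back. A queue model with
cumulants `κ` consists of operators and vectors `v w` such that the operator of `k` sends `v w` to
`v (k :: w)` plus a sum, over the segments `u` of the queue at the side of `k`, of `κ (k :: u)`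
times the vector of the rest. The coefficient of `v []` is then a universal polynomial in `κ`, the
`momentSeries`. It contains the cumulant of the full word once and otherwise only cumulants of
shorter words, so it can be inverted; the inverse is `cumulantSeries`.

These are bi-free cumulants because they add. In a free product an operator labelled `t` changes
only the run labelled `t` at its end of the queue, so the tensor products of queue vectors again
form a queue model, whose cumulants vanish on words with mixed labels (`isQueueModel_polyFaceOp`).
Summing these vectors over all labelings of a word gives a queue model for the sums of the
operators, with cumulants `∑ t, κ t` (`IsQueueModel.labelSum`, `moment_sum_of_isBiFree`).

Hence cumulant polynomials exist, and the rest uses only their characterizing properties. The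
leading term determines a central limit distribution recursively from its second moments
(`IsCentralLimit.ext`). If only `κ` of order two is nonzero, the sum of two bi-free copies is
distributed as `√2` times one copy; additivity and homogeneity give `2 R = √2 ^ n R`, so `R = 0` for
`n ≠ 2` (`isCentralLimit_of_momentSeries`).

On Fock space the elementary tensors along the queue form a queue model: creation inserts a vector
at one end and annihilation removes the vector at that end, so the only cumulants are inner products
of pairs (`isQueueModel_fockOp`). The Fock distribution is therefore a central limit distribution,
and it is positive as a vector state. Conversely, a positive semidefinite matrix is a Gram matrix
(`exists_gram_eq`); by uniqueness a central limit distribution with such second moments is a Fock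
distribution, hence positive. -/

namespace BiFree

/-! ### Cuts of words

A word lists letters from the newest to the oldest.  Putting the letters of one face in front, the
newest first, and the letters of the other face at the back, the newest last, arranges its letters
in a queue.  The cuts of the word split the queue into an initial and a final segment. -/

section Cuts

variable {L : Type*}

/-- The pairs consisting of an initial segment and of the remaining final segment of the queue of a
word; the letters satisfying `p` enter the queue at the front and the others at the back. -/
def cuts (p : L → Bool) : List L → List (List L × List L)
  | [] => [([], [])]
  | x :: w =>
    if p x then ([], x :: w) :: (cuts p w).map fun q => (x :: q.1, q.2)
    else (cuts p w).map (fun q => (q.1, x :: q.2)) ++ [(x :: w, [])]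

theorem length_of_mem_cuts {p : L → Bool} {w : List L} {q : List L × List L}
    (hq : q ∈ cuts p w) : q.1.length + q.2.length = w.length := by
  induction w generalizing q with
  | nil => simp_all [cuts]
  | cons x w ih =>
    rw [cuts] at hq
    split_ifs at hq
    · rcases List.mem_cons.1 hq with rfl | hq
      · simp
      · obtain ⟨r, hr, rfl⟩ := List.mem_map.1 hq
        have := ih hr
        simp only [List.length_cons]
        omega
    · rcases List.mem_append.1 hq with hq | hq
      · obtain ⟨r, hr, rfl⟩ := List.mem_map.1 hq
        have := ih hr
        simp only [List.length_cons]
        omega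
      · simp_all

theorem sublist_of_mem_cuts {p : L → Bool} {w : List L} {q : List L × List L}
    (hq : q ∈ cuts p w) : q.1.Sublist w ∧ q.2.Sublist w := by
  induction w generalizing q with
  | nil => simp_all [cuts]
  | cons x w ih =>
    rw [cuts] at hq
    split_ifs at hq
    · rcases List.mem_cons.1 hq with rfl | hq
      · simp
      · obtain ⟨r, hr, rfl⟩ := List.mem_map.1 hq
        exact ⟨(ih hr).1.cons_cons x, (ih hr).2.cons x⟩
    · rcases List.mem_append.1 hq with hq | hq
      · obtain ⟨r, hr, rfl⟩ := List.mem_map.1 hq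
        exact ⟨(ih hr).1.cons x, (ih hr).2.cons_cons x⟩
      · simp_all

/-- Segments are written in the order of the word, not of the queue, so the only cut with empty
second segment is `(w, [])`. -/
theorem sum_cuts_snd_nil {A : Type*} [AddCommMonoid A] (p : L → Bool) (w : List L)
    (g : List L × List L → A) (hg : ∀ u x v, g (u, x :: v) = 0) :
    ((cuts p w).map g).sum = g (w, []) := by
  induction w generalizing g with
  | nil => simp [cuts]
  | cons x w ih =>
    rw [cuts]
    split_ifs
    · simp only [List.map_cons, List.sum_cons, List.map_map, hg, zero_add]
      exact ih (fun q => g (x :: q.1, q.2)) fun u y v => hg _ _ _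
    · have h0 : ((cuts p w).map (g ∘ fun q => (q.1, x :: q.2))).sum = 0 :=
        List.sum_eq_zero fun y hy => by
          obtain ⟨r, _, rfl⟩ := List.mem_map.1 hy
          exact hg _ _ _
      simp [h0]

theorem sum_cuts_fst_nil {A : Type*} [AddCommMonoid A] (p : L → Bool) (w : List L)
    (g : List L × List L → A) (hg : ∀ x u v, g (x :: u, v) = 0) :
    ((cuts p w).map g).sum = g ([], w) := by
  induction w generalizing g with
  | nil => simp [cuts]
  | cons x w ih =>
    rw [cuts]
    split_ifs
    · have h0 : ((cuts p w).map (g ∘ fun q => (x :: q.1, q.2))).sum = 0 :=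
        List.sum_eq_zero fun y hy => by
          obtain ⟨r, _, rfl⟩ := List.mem_map.1 hy
          exact hg _ _ _
      simp [h0]
    · simp only [List.map_append, List.sum_append, List.map_map, List.map_cons, List.map_nil,
        List.sum_cons, List.sum_nil, hg, add_zero]
      exact ih (fun q => g (q.1, x :: q.2)) fun y u v => hg _ _ _

/-- The queue of a word. -/
def queue (p : L → Bool) : List L → List L
  | [] => []
  | x :: w => if p x then x :: queue p w else queue p w ++ [x]

theorem queue_eq_nil {p : L → Bool} {w : List L} : queue p w = [] ↔ w = [] := by
  cases w with
  | nil => simp [queue]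
  | cons x w => rw [queue]; split_ifs <;> simp

/-- Exchanging the faces turns the queue around; this reduces the right face to the left one. -/
theorem queue_not (p : L → Bool) (w : List L) : queue (fun x => !p x) w = (queue p w).reverse := by
  induction w with
  | nil => simp [queue]
  | cons x w ih => rw [queue, queue]; cases p x <;> simp [ih]

/-- The cuts whose first segment has one letter. -/
theorem sum_cuts_singleton {A : Type*} [AddCommMonoid A] (p : L → Bool) (w : List L)
    (g : List L → List L → A) (hg : ∀ u v, u.length ≠ 1 → g u v = 0) :
    ((cuts p w).map fun q => g q.1 (queue p q.2)).sum =
      match queue p w with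
      | [] => 0
      | x :: d => g [x] d := by
  induction w generalizing g with
  | nil => simp [cuts, queue, hg]
  | cons x w ih =>
    rw [cuts, queue]
    split_ifs with hx
    · have := sum_cuts_fst_nil p w (fun q => g (x :: q.1) (queue p q.2))
        fun y u v => hg _ _ (by simp)
      simp only [List.map_cons, List.sum_cons, List.map_map]
      rw [hg [] _ (by simp), zero_add]
      exact this
    · have h := ih (fun u v => g u (v ++ [x])) fun u v h => hg _ _ h
      simp only [List.map_append, List.sum_append, List.map_map, List.map_cons, List.map_nil,
        List.sum_cons, List.sum_nil, add_zero]
      have h2 : (fun q : List L × List L => g q.1 (queue p q.2)) ∘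
            (fun q : List L × List L => (q.1, x :: q.2)) =
          fun q => g q.1 (queue p q.2 ++ [x]) := by
        funext q; simp [queue, hx]
      rw [h2, h]
      -- The additional cut has the whole word as its first segment; it counts only if `x` is the
      -- only letter.
      rcases w with _ | ⟨y, w⟩
      · simp [queue]
      · rw [hg (x :: y :: w) _ (by simp), add_zero]
        cases hq : queue p (y :: w) with
        | nil => simp [queue_eq_nil] at hq
        | cons z d => simp

end Cuts

/-! ### Moments in terms of cumulants -/

section MomentSeries

variable {L : Type*} {A : Type*} [CommRing A]

/-- For a module with operators `Z k` and vectors `v w` such that `Z k (v w)` is the sum of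
`v (k :: w)` and of the `κ (k :: u) • v w'`, with `(u, w')` running over the cuts of `w` on the side
of `k`, this is the coefficient of `v []` in `Z kₙ (⋯ (Z k₁ (v w)))`. -/
def momentSeries (p : L → Bool) (κ : List L → A) : List L → List L → A
  | [], [] => 1
  | [], _ :: _ => 0
  | k :: m, w => momentSeries p κ m (k :: w) +
      ((cuts (fun x => p x == p k) w).map fun q : List L × List L =>
        κ (k :: q.1) * momentSeries p κ m q.2).sum

variable {p : L → Bool}

theorem momentSeries_congr {κ κ' : List L → A} (m w : List L)
    (h : ∀ u : List L, u ≠ [] → u.length ≤ m.length + w.length → κ u = κ' u) :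
    momentSeries p κ m w = momentSeries p κ' m w := by
  induction m generalizing w with
  | nil => cases w <;> simp [momentSeries]
  | cons k m ih =>
    rw [momentSeries, momentSeries]
    congr 1
    · exact ih _ fun u hu hl => h u hu (by simp only [List.length_cons] at hl ⊢; omega)
    · refine congrArg List.sum (List.map_congr_left fun q hq => ?_)
      have := length_of_mem_cuts hq
      rw [h (k :: q.1) (by simp) (by simp only [List.length_cons]; omega),
        ih _ fun u hu hl => h u hu (by simp only [List.length_cons] at hl ⊢; omega)]

/-- The restriction of a family of cumulants to the words of length less than `n`. -/
def truncate (n : ℕ) (κ : List L → A) (u : List L) : A :=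
  if u.length < n then κ u else 0

/-- The full word is reached in one way only: every letter but the last joins the queue, and the
last one absorbs the whole queue. All other terms contain shorter cumulants only. This triangularity
makes the passage from cumulants to moments invertible. -/
theorem momentSeries_eq_add {κ : List L → A} (m w : List L) (hm : m ≠ []) :
    momentSeries p κ m w =
      κ (m.reverse ++ w) + momentSeries p (truncate (m.length + w.length) κ) m w := by
  induction m generalizing w with
  | nil => exact absurd rfl hm
  | cons k m ih =>
    rcases m with _ | ⟨l, m⟩
    · have h : ∀ κ' : List L → A, momentSeries p κ' [k] w = κ' (k :: w) := fun κ' => by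
        rw [momentSeries, momentSeries, zero_add,
          sum_cuts_snd_nil _ _ _ fun u x v => by rw [momentSeries, mul_zero]]
        simp [momentSeries]
      rw [h, h]
      rw [truncate, if_neg (by simp only [List.length_cons, List.length_nil]; omega)]
      simp
    · rw [momentSeries, ih _ (by simp), momentSeries.eq_def p _ (k :: l :: m) w]
      have e : (l :: m).length + (k :: w).length = (k :: l :: m).length + w.length := by
        simp only [List.length_cons]; omega
      rw [e]
      -- A letter absorbed now leaves at least `l` outside its cumulant, and the remaining letters
      -- are fewer than the total; truncation changes neither factor.
      have h2 : ((cuts (fun x => p x == p k) w).map fun q =>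
            κ (k :: q.1) * momentSeries p κ (l :: m) q.2) =
          (cuts (fun x => p x == p k) w).map fun q =>
            truncate ((k :: l :: m).length + w.length) κ (k :: q.1) *
              momentSeries p (truncate ((k :: l :: m).length + w.length) κ) (l :: m) q.2 := by
        refine List.map_congr_left fun q hq => ?_
        have := length_of_mem_cuts hq
        rw [truncate, if_pos (by simp only [List.length_cons]; omega)]
        congr 1
        refine momentSeries_congr _ _ fun u hu hl => ?_
        rw [truncate, if_pos (by simp only [List.length_cons] at hl ⊢; omega)]
      rw [h2]
      simp [add_assoc]

theorem map_momentSeries {A' : Type*} [CommRing A'] (f : A →+* A') (κ : List L → A)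
    (m w : List L) :
    f (momentSeries p κ m w) = momentSeries p (fun u => f (κ u)) m w := by
  induction m generalizing w with
  | nil => cases w <;> simp [momentSeries]
  | cons k m ih =>
    simp only [momentSeries, map_add, map_list_sum, List.map_map, ih]
    congr 2
    refine List.map_congr_left fun q _ => ?_
    simp [ih]

/-- Each step forms cumulants of subwords only. With `B` the polynomials in a given set of
variables, this controls which moments occur in a cumulant. -/
theorem momentSeries_mem {R : Type*} [CommRing R] [Algebra R A] (B : Subalgebra R A)
    (κ : List L → A) (m w : List L)
    (h : ∀ u, u ≠ [] → u.Sublist (m.reverse ++ w) → κ u ∈ B) : momentSeries p κ m w ∈ B := by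
  induction m generalizing w with
  | nil =>
    cases w
    · exact B.one_mem
    · exact B.zero_mem
  | cons k m ih =>
    rw [momentSeries]
    have e : (k :: m).reverse ++ w = m.reverse ++ k :: w := by simp
    rw [e] at h
    refine B.add_mem (ih _ h) (list_sum_mem fun x hx => ?_)
    obtain ⟨q, hq, rfl⟩ := List.mem_map.1 hx
    have hs := sublist_of_mem_cuts hq
    exact B.mul_mem
      (h _ (by simp) ((hs.1.cons_cons k).trans (List.sublist_append_right _ _)))
      (ih _ fun u hu hl => h u hu
        (hl.trans ((List.Sublist.refl _).append (hs.2.trans (List.sublist_cons_self _ _)))))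

/-- In every product of cumulants each letter is absorbed exactly once, so the lengths add up to the
total number of letters. -/
theorem momentSeries_isWeightedHomogeneous {σ R : Type*} [CommRing R] {d : σ → ℕ}
    {κ : List L → MvPolynomial σ R}
    (h : ∀ u, MvPolynomial.IsWeightedHomogeneous d (κ u) u.length) (m w : List L) :
    MvPolynomial.IsWeightedHomogeneous d (momentSeries p κ m w) (m.length + w.length) := by
  induction m generalizing w with
  | nil =>
    cases w
    · simpa [momentSeries] using MvPolynomial.isWeightedHomogeneous_one R d
    · simpa [momentSeries] using MvPolynomial.isWeightedHomogeneous_zero R d _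
  | cons k m ih =>
    rw [momentSeries]
    have e : m.length + (k :: w).length = (k :: m).length + w.length := by
      simp only [List.length_cons]; omega
    refine MvPolynomial.IsWeightedHomogeneous.add (e ▸ ih _) ?_
    refine list_sum_mem (S := MvPolynomial.weightedHomogeneousSubmodule R d _) fun x hx => ?_
    obtain ⟨q, hq, rfl⟩ := List.mem_map.1 hx
    have hl := length_of_mem_cuts hq
    have e2 : (k :: q.1).length + (m.length + q.2.length) = (k :: m).length + w.length := by
      simp only [List.length_cons]; omega
    exact e2 ▸ (h _).mul (ih _)

theorem momentSeries_scale (c : A) (κ : List L → A) (m w : List L) :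
    momentSeries p (fun u => c ^ u.length * κ u) m w =
      c ^ (m.length + w.length) * momentSeries p κ m w := by
  induction m generalizing w with
  | nil => cases w <;> simp [momentSeries]
  | cons k m ih =>
    rw [momentSeries, momentSeries, ih, mul_add]
    congr 1
    · simp only [List.length_cons]
      ring_nf
    · rw [← List.sum_map_mul_left]
      refine congrArg List.sum (List.map_congr_left fun q hq => ?_)
      have hl := length_of_mem_cuts hq
      rw [ih, ← hl]
      simp only [List.length_cons]
      ring

/-- Vectors satisfying the recursion of `momentSeries`. -/
structure IsQueueModel {R M : Type*} [CommRing R] [AddCommGroup M] [Module R M] (p : L → Bool)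
    (κ : List L → R) (Z : L → Module.End R M) (v : List L → M) : Prop where
  apply (k : L) (w : List L) : Z k (v w) = v (k :: w) +
    ((cuts (fun x => p x == p k) w).map fun q => κ (k :: q.1) • v q.2).sum

variable {M : Type*} [AddCommGroup M] [Module A M] {κ : List L → A} {Z : L → Module.End A M}
  {v : List L → M}

/-- The reversal is due to the last operator of a product acting first. -/
theorem IsQueueModel.prod_apply (h : IsQueueModel p κ Z v) (f : M →ₗ[A] A)
    (hnil : f (v []) = 1) (hcons : ∀ x w, f (v (x :: w)) = 0) (m w : List L) :
    f ((m.map Z).prod (v w)) = momentSeries p κ m.reverse w := by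
  induction m using List.reverseRecOn generalizing w with
  | nil => cases w <;> simp [momentSeries, hnil, hcons]
  | append_singleton m k ih =>
    simp only [List.map_append, List.map_cons, List.map_nil, List.prod_append, List.prod_cons,
      List.prod_nil, mul_one, Module.End.mul_apply, h.apply, map_add, map_list_sum, List.map_map,
      List.reverse_append, List.reverse_cons, List.reverse_nil, List.nil_append,
      List.singleton_append, momentSeries, ih]
    congr 2
    refine List.map_congr_left fun q _ => ?_
    simp [ih]

variable (p κ Z) in
/-- The vectors obtained from `ξ` by the recursion of `momentSeries`. -/
def queueVector (ξ : M) : List L → M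
  | [] => ξ
  | k :: w => Z k (queueVector ξ w) -
      ((cuts (fun x => p x == p k) w).attach.map fun q =>
        κ (k :: q.1.1) • queueVector ξ q.1.2).sum
termination_by w => w.length
decreasing_by
  · simp
  · have := length_of_mem_cuts q.2
    simp only [List.length_cons]
    omega

theorem queueVector_isQueueModel (ξ : M) : IsQueueModel p κ Z (queueVector p κ Z ξ) where
  apply k w := by
    have h := List.attach_map_val (l := cuts (fun x => p x == p k) w)
      (f := fun q => κ (k :: q.1) • queueVector p κ Z ξ q.2)
    rw [queueVector, ← h, sub_add_cancel]

/-- For `m = []` this puts the queue vectors of nonempty words into the kernel of `f`, that is, into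
`X°` if `f` is the coefficient of `ξ`. Only then do they serve as tensor factors in a free product.
-/
theorem queueVector_coeff (ξ : M) (f : M →ₗ[A] A)
    (h : ∀ m : List L, f ((m.map Z).prod ξ) = momentSeries p κ m.reverse []) (m w : List L) :
    f ((m.map Z).prod (queueVector p κ Z ξ w)) = momentSeries p κ m.reverse w := by
  induction hn : w.length using Nat.strong_induction_on generalizing m w with
  | _ n ih =>
    rcases w with _ | ⟨k, w⟩
    · rw [queueVector]; exact h m
    -- The moment of `m ++ [k]` at `w` expands into the wanted coefficient and contracted terms at
    -- shorter words; the latter are known and cancel.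
    · have h1 := ih w.length (by simp [← hn]) (m ++ [k]) w rfl
      simp only [List.map_append, List.map_cons, List.map_nil, List.prod_append, List.prod_cons,
        List.prod_nil, mul_one, Module.End.mul_apply, (queueVector_isQueueModel ξ).apply, map_add,
        map_list_sum, List.map_map, List.reverse_append, List.reverse_cons, List.reverse_nil,
        List.nil_append, List.singleton_append, momentSeries] at h1
      have h2 : ((cuts (fun x => p x == p k) w).map
            (f ∘ (m.map Z).prod ∘ fun q => κ (k :: q.1) • queueVector p κ Z ξ q.2)) =
          (cuts (fun x => p x == p k) w).map fun q =>
            κ (k :: q.1) * momentSeries p κ m.reverse q.2 := by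
        refine List.map_congr_left fun q hq => ?_
        have hl := length_of_mem_cuts hq
        simp [ih q.2.length (by simp only [List.length_cons] at hn; omega) m q.2 rfl]
      rw [h2] at h1
      exact add_right_cancel h1

end MomentSeries

/-! ### Monomials of the free algebra and their reversal -/

section Monomials

variable {L : Type*}

@[simp]
theorem monomial_nil : monomial ([] : List L) = 1 := rfl

@[simp]
theorem monomial_cons (k : L) (m : List L) :
    monomial (k :: m) = FreeAlgebra.ι ℂ k * monomial m := by
  simp [monomial]

@[simp]
theorem monomial_append (m n : List L) : monomial (m ++ n) = monomial m * monomial n := by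
  simp [monomial]

@[simp]
theorem lift_monomial {A : Type*} [Ring A] [Algebra ℂ A] (z : L → A) (m : List L) :
    FreeAlgebra.lift ℂ z (monomial m) = (m.map z).prod := by
  rw [monomial, map_list_prod, List.map_map]
  congr 2
  funext k
  simp

theorem moment_distribution {A : Type*} [Ring A] [Algebra ℂ A] (φ : A →ₗ[ℂ] ℂ) (z : L → A)
    (m : List L) : moment (distribution φ z) m = φ (m.map z).prod := by
  simp [moment, distribution]

@[simp]
theorem star_monomial (m : List L) : star (monomial m) = monomial m.reverse := by
  induction m with
  | nil => simp
  | cons k m ih => simp [ih]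

variable (L) in
/-- The monomials form a basis of the noncommutative polynomials. -/
noncomputable def monomialBasis : Module.Basis (List L) ℂ (FreeAlgebra ℂ L) :=
  (FreeAlgebra.basisFreeMonoid ℂ L).reindex FreeMonoid.toList

@[simp]
theorem monomialBasis_apply (m : List L) : monomialBasis L m = monomial m := by
  simp [monomialBasis, FreeAlgebra.basisFreeMonoid, FreeAlgebra.equivMonoidAlgebraFreeMonoid,
    monomial, FreeMonoid.lift_apply]

theorem monomial_ext {M : Type*} [AddCommMonoid M] [Module ℂ M] {f g : FreeAlgebra ℂ L →ₗ[ℂ] M}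
    (h : ∀ m, f (monomial m) = g (monomial m)) : f = g :=
  (monomialBasis L).ext fun m => by simpa using h m

variable (L) in
/-- The linear anti-automorphism which reverses monomials. -/
noncomputable def reversal : FreeAlgebra ℂ L →ₗ[ℂ] FreeAlgebra ℂ L :=
  (MulOpposite.opLinearEquiv ℂ).symm.toLinearMap ∘ₗ FreeAlgebra.starHom.toLinearMap

theorem reversal_apply (x : FreeAlgebra ℂ L) : reversal L x = star x := rfl

theorem prod_map_apply_of_semiconj {M N : Type*} [AddCommGroup M] [Module ℂ M] [AddCommGroup N]
    [Module ℂ N] {f : M →ₗ[ℂ] N} {Z : L → Module.End ℂ M} {Z' : L → Module.End ℂ N}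
    (h : ∀ k x, f (Z k x) = Z' k (f x)) (m : List L) (x : M) :
    f ((m.map Z).prod x) = (m.map Z').prod (f x) := by
  induction m with
  | nil => simp
  | cons k m ih => simp [h, ih]

end Monomials

/-! ### The free product inside the free algebra -/

section WordAlgebra

variable {T : Type v} {B : T → Type u}

/-- The embedding of `X_t` into the noncommutative polynomials in all the basis vectors, which
maps `ξ` to `1`. -/
noncomputable def letterEmb (t : T) : (Option (B t) →₀ ℂ) →ₗ[ℂ] FreeAlgebra ℂ (Σ t, B t) :=
  Finsupp.linearCombination ℂ fun x => x.elim 1 fun b => FreeAlgebra.ι ℂ ⟨t, b⟩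

@[simp]
theorem letterEmb_none (t : T) : letterEmb (B := B) t (Finsupp.single none 1) = 1 := by
  simp [letterEmb]

@[simp]
theorem letterEmb_some (t : T) (b : B t) :
    letterEmb (B := B) t (Finsupp.single (some b) 1) = FreeAlgebra.ι ℂ ⟨t, b⟩ := by
  simp [letterEmb]

@[simp]
theorem star_letterEmb (t : T) (x : Option (B t) →₀ ℂ) :
    star (letterEmb (B := B) t x) = letterEmb t x := by
  suffices reversal _ ∘ₗ letterEmb (B := B) t = letterEmb t from LinearMap.congr_fun this x
  ext x
  cases x <;> simp [reversal_apply]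

open Classical in
/-- The left operator on noncommutative polynomials which extends `leftOp`. -/
noncomputable def polyLeftOp (t : T) (S : Module.End ℂ (Option (B t) →₀ ℂ)) :
    Module.End ℂ (FreeAlgebra ℂ (Σ t, B t)) :=
  (monomialBasis _).constr ℂ fun
    | [] => letterEmb t (S (Finsupp.single none 1))
    | a :: m => if h : a.1 = t then
          letterEmb t (S (Finsupp.single (some (h ▸ a.2)) 1)) * monomial m
        else letterEmb t (S (Finsupp.single none 1)) * monomial (a :: m)

/-- The right operator on noncommutative polynomials which extends `rightOp`. -/
noncomputable def polyRightOp (t : T) (S : Module.End ℂ (Option (B t) →₀ ℂ)) :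
    Module.End ℂ (FreeAlgebra ℂ (Σ t, B t)) :=
  reversal _ ∘ₗ polyLeftOp t S ∘ₗ reversal _

/-- The span of the monomials which do not begin with a letter of `B t`. -/
noncomputable def avoiding (t : T) : Submodule ℂ (FreeAlgebra ℂ (Σ t, B t)) :=
  Submodule.span ℂ (monomial '' {m | ∀ a ∈ m.head?, a.1 ≠ t})

theorem monomial_mem_avoiding {t : T} {m : List (Σ t, B t)} (h : ∀ a ∈ m.head?, a.1 ≠ t) :
    monomial m ∈ avoiding (B := B) t :=
  Submodule.subset_span ⟨m, h, rfl⟩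

theorem one_mem_avoiding (t : T) : (1 : FreeAlgebra ℂ (Σ t, B t)) ∈ avoiding t :=
  monomial_mem_avoiding (m := []) (by simp)

theorem letterEmb_eq_sum (t : T) (x : Option (B t) →₀ ℂ) :
    letterEmb (B := B) t x = x.sum fun i c => c • letterEmb t (Finsupp.single i 1) := by
  conv_lhs => rw [← Finsupp.sum_single x]
  rw [Finsupp.sum, map_sum]
  refine Finset.sum_congr rfl fun i _ => ?_
  simp only [← map_smul, Finsupp.smul_single, smul_eq_mul, mul_one]

theorem letterEmb_mul_mem_avoiding {s t : T} (hst : s ≠ t) (x : Option (B s) →₀ ℂ)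
    (hx : x none = 0) (y : FreeAlgebra ℂ (Σ t, B t)) : letterEmb s x * y ∈ avoiding t := by
  rw [letterEmb_eq_sum, Finsupp.sum, Finset.sum_mul]
  refine Submodule.sum_mem _ fun i hi => ?_
  rw [smul_mul_assoc]
  refine Submodule.smul_mem _ _ ?_
  rcases i with _ | b
  · simp [hx] at hi
  · have hy : y ∈ Submodule.span ℂ (Set.range (monomialBasis (Σ t, B t))) := by simp
    rw [letterEmb_some]
    induction hy using Submodule.span_induction with
    | zero => simp
    | add y z _ _ hy hz =>
      rw [mul_add]
      exact Submodule.add_mem _ hy hz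
    | smul c y _ hy =>
      rw [mul_smul_comm]
      exact Submodule.smul_mem _ _ hy
    | mem y hy =>
      obtain ⟨m, rfl⟩ := hy
      rw [monomialBasis_apply, ← monomial_cons]
      exact monomial_mem_avoiding (by simpa using hst)

/-- This is `λ_t(S) = V_t (S ⊗ I) V_t⁻¹` with the tensor product replaced by multiplication; the
condition on `y` says that it comes from `X(l,t)`, without the alternation of the remaining letters.
-/
theorem polyLeftOp_letterEmb_mul (t : T) (S : Module.End ℂ (Option (B t) →₀ ℂ))
    (x : Option (B t) →₀ ℂ) {y : FreeAlgebra ℂ (Σ t, B t)} (hy : y ∈ avoiding t) :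
    polyLeftOp t S (letterEmb t x * y) = letterEmb t (S x) * y := by
  induction hy using Submodule.span_induction with
  | zero => simp
  | add y z _ _ hy hz => simp only [mul_add, map_add, hy, hz]
  | smul c y _ hy => simp only [mul_smul_comm, map_smul, hy]
  | mem y hy =>
    obtain ⟨m, hm, rfl⟩ := hy
    suffices polyLeftOp t S ∘ₗ LinearMap.mulRight ℂ (monomial m) ∘ₗ letterEmb t =
        LinearMap.mulRight ℂ (monomial m) ∘ₗ letterEmb t ∘ₗ S from LinearMap.congr_fun this x
    ext i
    have key : ∀ n : List (Σ t, B t), polyLeftOp t S (monomial n) = _ := fun n => by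
      rw [← monomialBasis_apply, polyLeftOp, Module.Basis.constr_basis]
    rcases i with _ | b
    · simp only [LinearMap.comp_apply, Finsupp.lsingle_apply, letterEmb_none,
        LinearMap.mulRight_apply, one_mul, key]
      rcases m with _ | ⟨a, m⟩
      · simp
      · simp only
        rw [dif_neg (hm a (by simp))]
    · simp only [LinearMap.comp_apply, Finsupp.lsingle_apply, letterEmb_some,
        LinearMap.mulRight_apply]
      rw [← monomial_cons, key]
      simp

theorem polyRightOp_mul_letterEmb (t : T) (S : Module.End ℂ (Option (B t) →₀ ℂ))
    (x : Option (B t) →₀ ℂ) {y : FreeAlgebra ℂ (Σ t, B t)} (hy : star y ∈ avoiding t) :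
    polyRightOp t S (y * letterEmb t x) = y * letterEmb t (S x) := by
  simp [polyRightOp, reversal_apply, polyLeftOp_letterEmb_mul t S x hy]

variable (B) in
/-- The embedding of the free product into the noncommutative polynomials. -/
noncomputable def altEmb : (AltWord B →₀ ℂ) →ₗ[ℂ] FreeAlgebra ℂ (Σ t, B t) :=
  Finsupp.linearCombination ℂ fun m => monomial m.1

@[simp]
theorem altEmb_single (m : AltWord B) : altEmb B (Finsupp.single m 1) = monomial m.1 := by
  rw [altEmb, Finsupp.linearCombination_single, one_smul]

theorem leftIso_single (t : T) (x : Option (B t)) (m : LeftTail B t) :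
    leftIso t (Finsupp.single x 1 ⊗ₜ Finsupp.single m 1) =
      Finsupp.single (leftGlue t (x, m)) 1 := by
  simp [leftIso]

theorem rightIso_single (t : T) (x : Option (B t)) (m : RightTail B t) :
    rightIso t (Finsupp.single m 1 ⊗ₜ Finsupp.single x 1) =
      Finsupp.single (rightGlue t (m, x)) 1 := by
  simp [rightIso]

theorem leftOp_leftIso (t : T) (S : Module.End ℂ (Option (B t) →₀ ℂ)) (x : Option (B t) →₀ ℂ)
    (y : LeftTail B t →₀ ℂ) : leftOp t S (leftIso t (x ⊗ₜ y)) = leftIso t (S x ⊗ₜ y) := by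
  simp [leftOp]

theorem rightOp_rightIso (t : T) (S : Module.End ℂ (Option (B t) →₀ ℂ)) (x : Option (B t) →₀ ℂ)
    (y : RightTail B t →₀ ℂ) : rightOp t S (rightIso t (y ⊗ₜ x)) = rightIso t (y ⊗ₜ S x) := by
  simp [rightOp]

theorem altEmb_leftIso (t : T) (x : Option (B t) →₀ ℂ) (y : LeftTail B t →₀ ℂ) :
    altEmb B (leftIso t (x ⊗ₜ y)) =
      letterEmb t x * Finsupp.linearCombination ℂ (fun m => monomial m.1.1) y := by
  suffices altEmb B ∘ₗ (leftIso t).toLinearMap =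
      LinearMap.mul' ℂ _ ∘ₗ TensorProduct.map (letterEmb t)
        (Finsupp.linearCombination ℂ fun m : LeftTail B t => monomial m.1.1) from
    LinearMap.congr_fun this _
  ext x y
  simp only [TensorProduct.AlgebraTensorModule.curry_apply, LinearMap.comp_apply,
    TensorProduct.curry_apply, LinearMap.restrictScalars_apply, Finsupp.lsingle_apply,
    LinearEquiv.coe_coe, leftIso_single, altEmb_single, TensorProduct.map_tmul,
    LinearMap.mul'_apply, Finsupp.linearCombination_single, one_smul]
  rcases x with _ | b <;> simp [leftGlue]

theorem altEmb_rightIso (t : T) (x : Option (B t) →₀ ℂ) (y : RightTail B t →₀ ℂ) :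
    altEmb B (rightIso t (y ⊗ₜ x)) =
      Finsupp.linearCombination ℂ (fun m => monomial m.1.1) y * letterEmb t x := by
  suffices altEmb B ∘ₗ (rightIso t).toLinearMap =
      LinearMap.mul' ℂ _ ∘ₗ TensorProduct.map
        (Finsupp.linearCombination ℂ fun m : RightTail B t => monomial m.1.1) (letterEmb t) from
    LinearMap.congr_fun this _
  ext y x
  simp only [TensorProduct.AlgebraTensorModule.curry_apply, LinearMap.comp_apply,
    TensorProduct.curry_apply, LinearMap.restrictScalars_apply, Finsupp.lsingle_apply,
    LinearEquiv.coe_coe, rightIso_single, altEmb_single, TensorProduct.map_tmul,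
    LinearMap.mul'_apply, Finsupp.linearCombination_single, one_smul]
  rcases x with _ | b <;> simp [rightGlue]

theorem altEmb_leftOp (t : T) (S : Module.End ℂ (Option (B t) →₀ ℂ)) (x : AltWord B →₀ ℂ) :
    altEmb B (leftOp t S x) = polyLeftOp t S (altEmb B x) := by
  obtain ⟨x, rfl⟩ := (leftIso t).surjective x
  induction x with
  | zero => simp
  | add x y hx hy => simp only [map_add, hx, hy]
  | tmul x y =>
    rw [leftOp_leftIso, altEmb_leftIso, altEmb_leftIso, polyLeftOp_letterEmb_mul]
    refine Submodule.sum_mem _ fun m _ => Submodule.smul_mem _ _ ?_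
    exact monomial_mem_avoiding m.2

theorem altEmb_rightOp (t : T) (S : Module.End ℂ (Option (B t) →₀ ℂ)) (x : AltWord B →₀ ℂ) :
    altEmb B (rightOp t S x) = polyRightOp t S (altEmb B x) := by
  obtain ⟨x, rfl⟩ := (rightIso t).surjective x
  induction x with
  | zero => simp
  | add x y hx hy => simp only [map_add, hx, hy]
  | tmul x y =>
    rw [rightOp_rightIso, altEmb_rightIso, altEmb_rightIso, polyRightOp_mul_letterEmb]
    rw [← reversal_apply, Finsupp.linearCombination_apply, Finsupp.sum, map_sum]
    refine Submodule.sum_mem _ fun m _ => ?_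
    rw [map_smul, reversal_apply, star_monomial]
    refine Submodule.smul_mem _ _ (monomial_mem_avoiding ?_)
    rw [List.head?_reverse]
    exact m.2

/-- The empty word is the only monomial with a constant term, and `algebraMapInv` is an algebra
homomorphism, which makes the vacuum coefficient of products easy to compute. -/
theorem freeProductState_apply (S : Module.End ℂ (AltWord B →₀ ℂ)) :
    freeProductState B S =
      FreeAlgebra.algebraMapInv (altEmb B (S (Finsupp.single (AltWord.nil B) 1))) := by
  suffices Finsupp.lapply (AltWord.nil B) =
      (FreeAlgebra.algebraMapInv (R := ℂ)).toLinearMap ∘ₗ altEmb B from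
    LinearMap.congr_fun this _
  refine Finsupp.lhom_ext' fun m => LinearMap.ext_ring ?_
  simp only [LinearMap.comp_apply, Finsupp.lsingle_apply, altEmb_single, Finsupp.lapply_apply,
    AlgHom.toLinearMap_apply]
  obtain ⟨m, hm⟩ := m
  rcases m with _ | ⟨a, m⟩
  · exact (Finsupp.single_eq_same).trans (by simp)
  · have : (⟨a :: m, hm⟩ : AltWord B) ≠ AltWord.nil B := fun h => by
      simpa [AltWord.nil] using congrArg Subtype.val h
    refine (Finsupp.single_eq_of_ne this.symm).trans ?_
    simp [FreeAlgebra.algebraMapInv]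

theorem algebraMapInv_letterEmb (t : T) (x : Option (B t) →₀ ℂ) :
    FreeAlgebra.algebraMapInv (letterEmb (B := B) t x) = x none := by
  suffices (FreeAlgebra.algebraMapInv (R := ℂ)).toLinearMap ∘ₗ letterEmb (B := B) t =
      Finsupp.lapply none from LinearMap.congr_fun this _
  ext i
  rcases i with _ | b <;> simp [FreeAlgebra.algebraMapInv]

end WordAlgebra

/-! ### Runs of labelled words -/

section Runs

variable {T L : Type*}

/-- A run with label `t` in front of a sequence of runs; the empty run is omitted. -/
def glueRun (t : T) : List L → List (T × List L) → List (T × List L)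
  | [], m => m
  | x :: u, m => (t, x :: u) :: m

/-- The sequence of runs `m` does not begin with a run labelled `t`. -/
def NotHead (t : T) (m : List (T × List L)) : Prop := ∀ a ∈ m.head?, a.1 ≠ t

theorem glueRun_inj {t : T} {x y : List L} {m n : List (T × List L)} (hm : NotHead t m)
    (hn : NotHead t n) (h : glueRun t x m = glueRun t y n) : x = y ∧ m = n := by
  rcases x with _ | ⟨a, x⟩ <;> rcases y with _ | ⟨b, y⟩ <;> simp only [glueRun] at h
  · exact ⟨rfl, h⟩
  · exact absurd rfl (hm (t, b :: y) (by simp [h]))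
  · exact absurd rfl (hn (t, a :: x) (by simp [← h]))
  · simp_all

/-- Nonempty runs with alternating labels. -/
def IsReduced (m : List (T × List L)) : Prop :=
  (∀ a ∈ m, a.2 ≠ []) ∧ m.IsChain fun a b => a.1 ≠ b.1

theorem IsReduced.reverse {m : List (T × List L)} (h : IsReduced m) : IsReduced m.reverse :=
  ⟨fun a ha => h.1 a (List.mem_reverse.1 ha),
    List.isChain_reverse.2 (h.2.imp fun _ _ h => h.symm)⟩

theorem IsReduced.tail {a : T × List L} {m : List (T × List L)} (h : IsReduced (a :: m)) :
    IsReduced m :=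
  ⟨fun b hb => h.1 b (List.mem_cons_of_mem _ hb), (List.isChain_cons.1 h.2).2⟩

theorem IsReduced.notHead {a : T × List L} {m : List (T × List L)} (h : IsReduced (a :: m)) :
    NotHead a.1 m :=
  fun b hb => ((List.isChain_cons.1 h.2).1 b hb).symm

variable [DecidableEq T]

/-- This mirrors the inverse of `V_t`: an empty `x` plays the role of the factor `ξ_t`. -/
theorem IsReduced.exists_glueRun {m : List (T × List L)} (h : IsReduced m) (t : T) :
    ∃ x n, m = glueRun t x n ∧ NotHead t n ∧ IsReduced n := by
  rcases m with _ | ⟨⟨s, u⟩, m⟩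
  · exact ⟨[], [], rfl, by simp [NotHead], h⟩
  · by_cases hs : s = t
    · subst hs
      rcases u with _ | ⟨a, u⟩
      · exact absurd rfl (h.1 _ List.mem_cons_self)
      · exact ⟨a :: u, m, rfl, h.notHead, h.tail⟩
    · exact ⟨[], _, rfl, by simpa [NotHead] using hs, h⟩

/-- Put a letter with label `t` in front of a sequence of runs. -/
def pushFront (t : T) (k : L) : List (T × List L) → List (T × List L)
  | [] => [(t, [k])]
  | a :: m => if a.1 = t then (t, k :: a.2) :: m else (t, [k]) :: a :: m

theorem pushFront_glueRun (t : T) (k : L) (x : List L) {m : List (T × List L)}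
    (hm : NotHead t m) : pushFront t k (glueRun t x m) = (t, k :: x) :: m := by
  rcases x with _ | ⟨a, x⟩
  · rcases m with _ | ⟨a, m⟩
    · rfl
    · simp only [glueRun, pushFront]
      rw [if_neg (hm a (by simp))]
  · simp [glueRun, pushFront]

theorem IsReduced.pushFront {m : List (T × List L)} (h : IsReduced m) (t : T) (k : L) :
    IsReduced (pushFront t k m) := by
  obtain ⟨x, n, rfl, h1, h2⟩ := h.exists_glueRun t
  rw [pushFront_glueRun t k x h1]
  refine ⟨fun a ha => ?_, List.isChain_cons.2 ⟨fun a ha => (h1 a ha).symm, h2.2⟩⟩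
  rcases List.mem_cons.1 ha with rfl | ha
  · simp
  · exact h2.1 a ha

/-- Put a letter with label `t` at the end of a sequence of runs.  Runs list their letters from
the newest to the oldest. -/
def pushBack (t : T) (k : L) (m : List (T × List L)) : List (T × List L) :=
  (pushFront t k m.reverse).reverse

theorem pushBack_cons (t : T) (k : L) (a : T × List L) {m : List (T × List L)} (hm : m ≠ []) :
    pushBack t k (a :: m) = a :: pushBack t k m := by
  have : ∀ n : List (T × List L), n ≠ [] →
      pushFront t k (n ++ [a]) = pushFront t k n ++ [a] := fun n hn => by
    rcases n with _ | ⟨b, n⟩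
    · exact absurd rfl hn
    · simp only [List.cons_append, pushFront]
      split_ifs <;> simp
  simp [pushBack, this, hm]

/-- A letter entering at the back can join the first run only if that run is the last one too and
has the same label. -/
theorem pushBack_glueRun {s t : T} (k : L) (x : List L) {m : List (T × List L)}
    (h : m ≠ [] ∨ s ≠ t) :
    pushBack s k (glueRun t x m) = glueRun t x (pushBack s k m) := by
  rcases x with _ | ⟨a, x⟩
  · rfl
  · by_cases hm : m = []
    · subst hm
      have : t ≠ s := (h.resolve_left (by simp)).symm
      simp [glueRun, pushBack, pushFront, this]
    · simp only [glueRun]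
      exact pushBack_cons s k _ hm

theorem pushBack_glueRun_nil (t : T) (k : L) (x : List L) :
    pushBack t k (glueRun t x []) = glueRun t (k :: x) [] := by
  rcases x with _ | ⟨a, x⟩ <;> simp [glueRun, pushBack, pushFront]

theorem notHead_pushBack {s t : T} (k : L) {m : List (T × List L)} (hm : NotHead t m)
    (h : m ≠ [] ∨ s ≠ t) : NotHead t (pushBack s k m) := by
  rcases m with _ | ⟨a, _ | ⟨b, m⟩⟩
  · simpa [pushBack, pushFront, NotHead] using h
  · have := hm a (by simp)
    simp only [pushBack, List.reverse_singleton, pushFront]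
    split_ifs with h2
    · simpa [NotHead, ← h2] using this
    · simpa [NotHead] using this
  · rw [pushBack_cons _ _ _ (by simp)]
    simpa [NotHead] using hm

theorem IsReduced.pushBack {m : List (T × List L)} (h : IsReduced m) (t : T) (k : L) :
    IsReduced (pushBack t k m) :=
  (h.reverse.pushFront t k).reverse

/-- The maximal runs of letters with the same label in the queue of a labelled word, each written
as a word. -/
def runs (p : L → Bool) : List (T × L) → List (T × List L)
  | [] => []
  | a :: w => if p a.2 then pushFront a.1 a.2 (runs p w) else pushBack a.1 a.2 (runs p w)

theorem isReduced_runs (p : L → Bool) (w : List (T × L)) : IsReduced (runs p w) := by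
  induction w with
  | nil => simp [runs, IsReduced]
  | cons a w ih =>
    rw [runs]
    split_ifs
    · exact ih.pushFront _ _
    · exact ih.pushBack _ _

theorem runs_not (p : L → Bool) (w : List (T × L)) :
    runs (fun x => !p x) w = (runs p w).reverse := by
  induction w with
  | nil => rfl
  | cons a w ih =>
    rw [runs, runs, ih]
    cases p a.2 <;> simp [pushBack]

/-- A run lists its letters by age, so within a single run the end at which a letter enters is
invisible. -/
theorem runs_eq_of_forall {p : L → Bool} {t : T} {w : List (T × L)} (h : ∀ a ∈ w, a.1 = t) :
    runs p w = glueRun t (w.map Prod.snd) [] := by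
  induction w with
  | nil => rfl
  | cons a w ih =>
    rw [runs, ih fun b hb => h b (List.mem_cons_of_mem _ hb), h a List.mem_cons_self,
      pushBack_glueRun_nil, pushFront_glueRun _ _ _ (by simp [NotHead])]
    simp [glueRun]

theorem exists_mem_pushFront {t : T} {k : L} {m : List (T × List L)} {s : T}
    (h : s = t ∨ ∃ r ∈ m, r.1 = s) : ∃ r ∈ pushFront t k m, r.1 = s := by
  rcases m with _ | ⟨a, m⟩
  · simp_all [pushFront]
  · rw [pushFront]
    split_ifs with ha
    · rcases h with rfl | ⟨r, hr, rfl⟩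
      · exact ⟨_, List.mem_cons_self, rfl⟩
      · rcases List.mem_cons.1 hr with rfl | hr
        · exact ⟨_, List.mem_cons_self, ha.symm⟩
        · exact ⟨r, List.mem_cons_of_mem _ hr, rfl⟩
    · rcases h with rfl | ⟨r, hr, rfl⟩
      · exact ⟨_, List.mem_cons_self, rfl⟩
      · exact ⟨r, List.mem_cons_of_mem _ hr, rfl⟩

theorem exists_mem_runs {p : L → Bool} {w : List (T × L)} {a : T × L} (h : a ∈ w) :
    ∃ r ∈ runs p w, r.1 = a.1 := by
  induction w with
  | nil => simp at h
  | cons b w ih =>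
    have h' : a.1 = b.1 ∨ ∃ r ∈ runs p w, r.1 = a.1 := by
      rcases List.mem_cons.1 h with rfl | h
      · exact Or.inl rfl
      · exact Or.inr (ih h)
    rw [runs]
    split_ifs
    · exact exists_mem_pushFront h'
    · obtain ⟨r, hr, h2⟩ := exists_mem_pushFront (k := b.2) (m := (runs p w).reverse)
        (h'.imp_right fun ⟨r, hr, h2⟩ => ⟨r, List.mem_reverse.2 hr, h2⟩)
      exact ⟨r, List.mem_reverse.2 hr, h2⟩

/-- The cuts of a labelled word with first segment labelled `t` are the cuts of its first run. -/
theorem sum_cuts_runs {A : Type*} [AddCommMonoid A] (p : L → Bool) (t : T) (w : List (T × L))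
    (g : List L → List (T × List L) → A) (x : List L) (m : List (T × List L))
    (hm : NotHead t m) (hw : runs p w = glueRun t x m) :
    ((cuts (fun a => p a.2) w).map fun q =>
        if ∀ a ∈ q.1, a.1 = t then g (q.1.map Prod.snd) (runs p q.2) else 0).sum =
      ((cuts p x).map fun r => g r.1 (glueRun t r.2 m)).sum := by
  induction w generalizing g x m with
  | nil =>
    obtain ⟨rfl, rfl⟩ := glueRun_inj (x := []) (m := []) (by simp [NotHead]) hm hw
    simp [cuts, runs, glueRun]
  | cons a w ih =>
    obtain ⟨s, y⟩ := a
    rw [cuts]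
    by_cases hy : p y
    · obtain ⟨x₀, m₀, h₀, hm₀, -⟩ := (isReduced_runs p w).exists_glueRun s
      have hw' : runs p ((s, y) :: w) = glueRun s (y :: x₀) m₀ := by
        rw [runs, if_pos hy, h₀, pushFront_glueRun _ _ _ hm₀]; rfl
      rw [if_pos hy]
      by_cases hs : s = t
      · subst hs
        obtain ⟨rfl, rfl⟩ := glueRun_inj hm hm₀ (hw.symm.trans hw')
        have := ih (fun u => g (y :: u)) x₀ m hm h₀
        rw [cuts, if_pos hy]
        simp only [List.map_cons, List.sum_cons, List.map_map]
        congr 1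
        · simp [hw']
        · refine Eq.trans (congrArg List.sum (List.map_congr_left fun q _ => ?_)) this
          simp only [Function.comp_apply, List.forall_mem_cons, true_and, List.map_cons]
      -- The queue begins with a run of the other label `s`; the run labelled `t` is empty and only
      -- the cut with empty first segment counts.
      · obtain ⟨rfl, rfl⟩ := glueRun_inj (x := []) (m := glueRun s (y :: x₀) m₀)
          (by simpa [NotHead, glueRun] using hs) hm (hw'.symm.trans hw)
        simp [cuts, hw', hs, Function.comp_def, glueRun]
    · obtain ⟨x₀, m₀, h₀, hm₀, -⟩ := (isReduced_runs p w).exists_glueRun t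
      rw [if_neg hy]
      have hr : ∀ v, runs p ((s, y) :: v) = pushBack s y (runs p v) := fun v => by
        rw [runs, if_neg hy]
      have h1 := ih (fun u n => g u (pushBack s y n)) x₀ m₀ hm₀ h₀
      simp only [List.map_append, List.sum_append, List.map_map, List.map_cons, List.map_nil,
        List.sum_cons, List.sum_nil, add_zero, Function.comp_def, hr]
      rw [h1]
      -- The new letter enters at the back. Unless the queue consists of at most a run labelled `t`
      -- and the new letter also has this label, the first run is unaffected.
      by_cases hc : m₀ ≠ [] ∨ s ≠ t
      · have hw' : runs p ((s, y) :: w) = glueRun t x₀ (pushBack s y m₀) := by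
          rw [hr, h₀, pushBack_glueRun _ _ hc]
        obtain ⟨rfl, rfl⟩ := glueRun_inj hm (notHead_pushBack y hm₀ hc) (hw.symm.trans hw')
        -- The additional cut takes the whole word, which has a letter with another label.
        rw [if_neg, add_zero]
        · simp only [pushBack_glueRun _ _ hc]
        · intro hall
          have h3 := glueRun_inj hm₀ (n := []) (by simp [NotHead]) (h₀.symm.trans
            (runs_eq_of_forall fun b hb => hall b (List.mem_cons_of_mem _ hb)))
          exact hc.elim (fun h => h h3.2) fun h => h (hall _ List.mem_cons_self)
      · push Not at hc
        obtain ⟨rfl, rfl⟩ := hc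
        have hw' : runs p ((s, y) :: w) = glueRun s (y :: x₀) [] := by
          rw [hr, h₀, pushBack_glueRun_nil]
        obtain ⟨rfl, rfl⟩ := glueRun_inj hm hm₀ (hw.symm.trans hw')
        have hall : ∀ a ∈ w, a.1 = s := fun a ha => by
          obtain ⟨r, hr, h2⟩ := exists_mem_runs (p := p) ha
          rw [h₀] at hr
          rcases x₀ with _ | ⟨b, x₀⟩
          · simp [glueRun] at hr
          · rw [glueRun, List.mem_singleton] at hr
            rw [← h2, hr]
        have h3 := glueRun_inj hm₀ hm₀ (h₀.symm.trans (runs_eq_of_forall hall))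
        rw [if_pos (by simpa using hall), cuts, if_neg hy]
        simp only [pushBack_glueRun_nil, Function.comp_def, h3.1, List.map_append,
          List.sum_append, List.map_map, List.map_cons, List.map_nil, List.sum_cons, List.sum_nil,
          add_zero, runs]
        rfl

/-- The cumulants of a bi-free family of families with cumulants `κ t`. -/
def mixedCumulants {R : Type*} [Zero R] (κ : T → List L → R) : List (T × L) → R
  | [] => 0
  | a :: u => if ∀ b ∈ u, b.1 = a.1 then κ a.1 (a.2 :: u.map Prod.snd) else 0

end Runs

/-! ### Queue models on free products -/

section Free

variable {T : Type v} {B : T → Type u} {L : Type*}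

/-- The vector of the free product given by a sequence of runs. -/
noncomputable def runVector (vec : ∀ t, List L → (Option (B t) →₀ ℂ)) (m : List (T × List L)) :
    FreeAlgebra ℂ (Σ t, B t) :=
  (m.map fun r => letterEmb r.1 (vec r.1 r.2)).prod

variable {vec : ∀ t, List L → (Option (B t) →₀ ℂ)}

theorem star_runVector (m : List (T × List L)) :
    star (runVector vec m) = runVector vec m.reverse := by
  induction m with
  | nil => simp [runVector]
  | cons a m ih =>
    simp only [runVector] at ih
    simp [runVector, ih]

theorem runVector_glueRun (hnil : ∀ t, vec t [] = Finsupp.single none 1) (t : T) (x : List L) (m : List (T × List L)) :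
    runVector vec (glueRun t x m) = letterEmb t (vec t x) * runVector vec m := by
  rcases x with _ | ⟨a, x⟩
  · simp [glueRun, hnil]
  · simp [glueRun, runVector]

theorem runVector_mem_avoiding (hcons : ∀ t a u, vec t (a :: u) none = 0) {t : T}
    {m : List (T × List L)} (hm : IsReduced m) (ht : NotHead t m) :
    runVector vec m ∈ avoiding t := by
  rcases m with _ | ⟨⟨s, u⟩, m⟩
  · simpa [runVector] using one_mem_avoiding t
  · rcases u with _ | ⟨a, u⟩
    · exact absurd rfl (hm.1 _ List.mem_cons_self)
    · simp only [runVector, List.map_cons, List.prod_cons]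
      exact letterEmb_mul_mem_avoiding (ht (s, a :: u) (by simp)) _ (hcons _ _ _) _

variable [DecidableEq T]

/-- The operator acts on the factor `vec t x` of the first run only, or on `ξ_t` if the queue does
not begin with label `t`. There `hS` gives the cuts of `x`, which by `sum_cuts_runs` are the cuts of
`w` with first segment labelled `t`; the mixed cumulants vanish on all other cuts. -/
theorem polyLeftOp_runVector {κ : T → List L → ℂ}
    (hnil : ∀ t, vec t [] = Finsupp.single none 1)
    (hcons : ∀ t a u, vec t (a :: u) none = 0) (p : L → Bool) (t : T) (k : L) (hk : p k)
    (S : Module.End ℂ (Option (B t) →₀ ℂ))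
    (hS : ∀ w, S (vec t w) = vec t (k :: w) +
      ((cuts p w).map fun q => κ t (k :: q.1) • vec t q.2).sum) (w : List (T × L)) :
    polyLeftOp t S (runVector vec (runs p w)) = runVector vec (runs p ((t, k) :: w)) +
      ((cuts (fun a => p a.2) w).map fun q =>
        mixedCumulants κ ((t, k) :: q.1) • runVector vec (runs p q.2)).sum := by
  obtain ⟨x, m, hw, hm, hr⟩ := (isReduced_runs p w).exists_glueRun t
  have h1 : runVector vec (runs p ((t, k) :: w)) = letterEmb t (vec t (k :: x)) *
      runVector vec m := by
    rw [runs, if_pos hk, hw, pushFront_glueRun _ _ _ hm, ← runVector_glueRun hnil]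
    rfl
  have h2 := sum_cuts_runs p t w (fun u n => κ t (k :: u) • runVector vec n) x m hm hw
  have h3 : ((cuts (fun a => p a.2) w).map fun q =>
        mixedCumulants κ ((t, k) :: q.1) • runVector vec (runs p q.2)) =
      (cuts (fun a => p a.2) w).map fun q => if ∀ a ∈ q.1, a.1 = t then
        κ t (k :: q.1.map Prod.snd) • runVector vec (runs p q.2) else 0 := by
    refine List.map_congr_left fun q _ => ?_
    simp only [mixedCumulants]
    split_ifs <;> simp
  rw [h1, h3, h2, hw, runVector_glueRun hnil,
    polyLeftOp_letterEmb_mul t S _ (runVector_mem_avoiding hcons hr hm), hS, map_add, add_mul,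
    map_list_sum, ← List.sum_map_mul_right, List.map_map]
  congr 2
  refine List.map_congr_left fun q _ => ?_
  simp [runVector_glueRun hnil]

/-- The operators of a family of two-faced families on the noncommutative polynomials in the basis
vectors. -/
noncomputable def polyFaceOp (p : L → Bool) (S : ∀ t, L → Module.End ℂ (Option (B t) →₀ ℂ))
    (a : T × L) : Module.End ℂ (FreeAlgebra ℂ (Σ t, B t)) :=
  if p a.2 then polyLeftOp a.1 (S a.1 a.2) else polyRightOp a.1 (S a.1 a.2)

theorem isQueueModel_polyFaceOp {κ : T → List L → ℂ}
    (hnil : ∀ t, vec t [] = Finsupp.single none 1)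
    (hcons : ∀ t a u, vec t (a :: u) none = 0) (p : L → Bool)
    (S : ∀ t, L → Module.End ℂ (Option (B t) →₀ ℂ))
    (hS : ∀ t, IsQueueModel p (κ t) (S t) (vec t)) :
    IsQueueModel (fun a : T × L => p a.2) (mixedCumulants κ) (polyFaceOp p S)
      fun w => runVector vec (runs p w) where
  apply := by
    rintro ⟨t, k⟩ w
    have hS' := (hS t).apply k
    by_cases hk : p k
    · simp only [hk, beq_true] at hS' ⊢
      rw [polyFaceOp, if_pos hk]
      exact polyLeftOp_runVector hnil hcons p t k hk _ hS' w
    · simp only [Bool.not_eq_true] at hk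
      simp only [hk, beq_false] at hS' ⊢
      -- The right face is the left face of the complementary predicate, transported by the reversal
      -- of monomials.
      have h := polyLeftOp_runVector hnil hcons (fun x => !p x) t k (by simp [hk]) _ hS' w
      have h' := congrArg (reversal _) h
      simp only [map_add, map_list_sum, List.map_map, Function.comp_def, map_smul] at h'
      simp only [reversal_apply, star_runVector, runs_not, List.reverse_reverse] at h'
      rw [polyFaceOp, if_neg (by simp [hk]), polyRightOp]
      simp only [LinearMap.comp_apply, reversal_apply, star_runVector]
      exact h'

end Free

/-! ### Sums over labelings -/

section Labelings

variable {T L M : Type*} [Fintype T] [AddCommMonoid M]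

/-- The sum of the values of `V` on the words which are obtained from a word by labeling its
letters. -/
def labelSum (V : List (T × L) → M) : List L → M
  | [] => V []
  | k :: w => ∑ t, labelSum (fun x => V ((t, k) :: x)) w

theorem labelSum_zero (w : List L) : labelSum (fun _ : List (T × L) => (0 : M)) w = 0 := by
  induction w with
  | nil => rfl
  | cons k w ih => simp [labelSum, ih]

theorem labelSum_add (V W : List (T × L) → M) (w : List L) :
    labelSum (fun x => V x + W x) w = labelSum V w + labelSum W w := by
  induction w generalizing V W with
  | nil => rfl
  | cons k w ih => simp [labelSum, ih, Finset.sum_add_distrib]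

theorem map_labelSum {N : Type*} [AddCommMonoid N] (f : M →+ N) (V : List (T × L) → M)
    (w : List L) : f (labelSum V w) = labelSum (fun x => f (V x)) w := by
  induction w generalizing V with
  | nil => rfl
  | cons k w ih => simp [labelSum, ih]

theorem sum_list_sum {ι : Type*} (l : List ι) (F : T → ι → M) :
    ∑ t, (l.map (F t)).sum = (l.map fun i => ∑ t, F t i).sum := by
  induction l with
  | nil => simp
  | cons i l ih => simp [Finset.sum_add_distrib, ih]

theorem labelSum_sum (V : T → List (T × L) → M) (w : List L) :
    labelSum (fun x => ∑ t, V t x) w = ∑ t, labelSum (V t) w := by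
  induction w generalizing V with
  | nil => rfl
  | cons k w ih =>
    simp only [labelSum]
    rw [Finset.sum_comm]
    exact Finset.sum_congr rfl fun s _ => ih fun t x => V t ((s, k) :: x)

/-- Labeling commutes with cutting, since the place of a cut depends on the faces of the letters and
not on their labels. -/
theorem labelSum_cuts (p : L → Bool) (F : List (T × L) → List (T × L) → M) (w : List L) :
    labelSum (fun x => ((cuts (fun a : T × L => p a.2) x).map fun q => F q.1 q.2).sum) w =
      ((cuts p w).map fun q => labelSum (fun u => labelSum (F u) q.2) q.1).sum := by
  induction w generalizing F with
  | nil => simp [labelSum, cuts]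
  | cons k w ih =>
    rw [labelSum, cuts]
    by_cases hk : p k
    · simp only [cuts, hk, if_true, List.map_cons, List.sum_cons, List.map_map, Function.comp_def,
        labelSum_add, Finset.sum_add_distrib]
      congr 1
      rw [Finset.sum_congr rfl fun t _ => ih fun u => F ((t, k) :: u), sum_list_sum]
      rfl
    · simp only [cuts, hk, if_false, List.map_append, List.sum_append, List.map_cons, List.map_nil,
        List.sum_cons, List.sum_nil, add_zero, List.map_map, Function.comp_def,
        labelSum_add, Finset.sum_add_distrib, Bool.false_eq_true]
      congr 1
      rw [Finset.sum_congr rfl fun t _ => ih fun u v => F u ((t, k) :: v), sum_list_sum]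
      refine congrArg List.sum (List.map_congr_left fun q _ => ?_)
      exact (labelSum_sum _ _).symm

theorem labelSum_ite [DecidableEq T] (t : T) (g : List L → M) (w : List L) :
    labelSum (fun x : List (T × L) => if ∀ b ∈ x, b.1 = t then g (x.map Prod.snd) else 0) w =
      g w := by
  induction w generalizing g with
  | nil => simp [labelSum]
  | cons k w ih =>
    rw [labelSum, Finset.sum_eq_single t]
    · rw [← ih fun u => g (k :: u)]
      congr 1
      funext x
      exact if_congr (by simp) rfl rfl
    · intro s _ hs
      simp [hs, labelSum_zero]
    · simp

theorem labelSum_cons_eq_zero (V : List (T × L) → M) (hV : ∀ a x, V (a :: x) = 0) (k : L)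
    (w : List L) : labelSum V (k :: w) = 0 := by
  simp [labelSum, hV, labelSum_zero]

theorem labelSum_smul {R : Type*} [Semiring R] [Module R M] (V : List (T × L) → R) (x : M)
    (w : List L) : labelSum (fun u => V u • x) w = labelSum V w • x :=
  (map_labelSum (AddMonoidHom.flip (smulAddHom R M) x) V w).symm

/-- After a contraction by `Z (t, k)`, the sum over labelings of the absorbed segment retains the
constant labeling `t` alone, and the labelings of the rest recombine to the vector of the rest.
Summation over `t` then adds the cumulants. -/
theorem IsQueueModel.labelSum {R N : Type*} [CommRing R] [AddCommGroup N] [Module R N]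
    [DecidableEq T] {p : L → Bool} {κ : T → List L → R} {Z : T × L → Module.End R N}
    {V : List (T × L) → N}
    (h : IsQueueModel (fun a : T × L => p a.2) (mixedCumulants κ) Z V) :
    IsQueueModel p (fun u => ∑ t, κ t u) (fun k => ∑ t, Z (t, k)) (labelSum V) where
  apply k w := by
    have h1 : ∀ t, Z (t, k) (BiFree.labelSum V w) =
        BiFree.labelSum (fun x => V ((t, k) :: x)) w +
        ((cuts (fun x => p x == p k) w).map fun q =>
          κ t (k :: q.1) • BiFree.labelSum V q.2).sum := fun t => by
      rw [show Z (t, k) (BiFree.labelSum V w) = (Z (t, k)).toAddMonoidHom (BiFree.labelSum V w)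
        from rfl, map_labelSum]
      simp only [LinearMap.toAddMonoidHom_coe, h.apply, labelSum_add]
      congr 1
      rw [labelSum_cuts (fun x => p x == p k)
        (fun u v => mixedCumulants κ ((t, k) :: u) • V v)]
      refine congrArg List.sum (List.map_congr_left fun q _ => ?_)
      have h2 : ∀ u : List (T × L), BiFree.labelSum
          (fun v => mixedCumulants κ ((t, k) :: u) • V v) q.2 =
            mixedCumulants κ ((t, k) :: u) • BiFree.labelSum V q.2 := fun u =>
        (map_labelSum (smulAddHom R N _) V q.2).symm
      simp only [h2]
      rw [labelSum_smul]
      congr 1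
      exact labelSum_ite t (fun u => κ t (k :: u)) q.1
    simp only [LinearMap.sum_apply, h1, Finset.sum_add_distrib, sum_list_sum, Finset.sum_smul]
    rfl

end Labelings

/-! ### Additivity -/

section Additivity

variable {T : Type v} {I J : Type u}

/-- The operators of a bi-free family on the free product. -/
noncomputable def faceOp {B : T → Type u} (S : ∀ t, I ⊕ J → Module.End ℂ (Option (B t) →₀ ℂ))
    (a : T × (I ⊕ J)) : Module.End ℂ (AltWord B →₀ ℂ) :=
  match a.2 with
  | Sum.inl i => leftOp a.1 (S a.1 (Sum.inl i))
  | Sum.inr j => rightOp a.1 (S a.1 (Sum.inr j))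

theorem altEmb_faceOp {B : T → Type u} (S : ∀ t, I ⊕ J → Module.End ℂ (Option (B t) →₀ ℂ))
    (a : T × (I ⊕ J)) (x : AltWord B →₀ ℂ) :
    altEmb B (faceOp S a x) = polyFaceOp Sum.isLeft S a (altEmb B x) := by
  obtain ⟨t, i | j⟩ := a
  · simp [faceOp, polyFaceOp, altEmb_leftOp]
  · simp [faceOp, polyFaceOp, altEmb_rightOp]

theorem distribution_faceOp_monomial {B : T → Type u}
    (S : ∀ t, I ⊕ J → Module.End ℂ (Option (B t) →₀ ℂ)) (m : List (T × (I ⊕ J))) :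
    distribution (freeProductState B) (faceOp S) (monomial m) =
      FreeAlgebra.algebraMapInv ((m.map (polyFaceOp Sum.isLeft S)).prod 1) := by
  refine (moment_distribution _ _ m).trans ?_
  rw [freeProductState_apply, prod_map_apply_of_semiconj (altEmb_faceOp S), altEmb_single]
  rfl

theorem polyFaceOp_letterEmb {B : T → Type u} {L : Type*} (p : L → Bool)
    (S : ∀ t, L → Module.End ℂ (Option (B t) →₀ ℂ)) (t : T) (k : L) (x : Option (B t) →₀ ℂ) :
    letterEmb t (S t k x) = polyFaceOp p S (t, k) (letterEmb t x) := by
  rw [polyFaceOp]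
  split_ifs
  · simpa using (polyLeftOp_letterEmb_mul t (S t k) x (one_mem_avoiding t)).symm
  · simpa using (polyRightOp_mul_letterEmb t (S t k) x (y := 1)
      (by simpa using one_mem_avoiding t)).symm

/-- The moments of one of the families in a free product. -/
theorem distribution_faceOp_marginal {B : T → Type u}
    (S : ∀ t, I ⊕ J → Module.End ℂ (Option (B t) →₀ ℂ)) (t : T) (m : List (I ⊕ J)) :
    distribution (freeProductState B) (faceOp S) (monomial (m.map fun k => (t, k))) =
      (m.map (S t)).prod (Finsupp.single none 1) none := by
  rw [distribution_faceOp_monomial, List.map_map, ← algebraMapInv_letterEmb (B := B) t,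
    prod_map_apply_of_semiconj (polyFaceOp_letterEmb Sum.isLeft S t), letterEmb_none]
  rfl

/-- The first factor is a vector of some `X°`, and a homomorphism which kills one factor kills the
product. -/
theorem algebraMapInv_runVector [DecidableEq T] {B : T → Type u} {L : Type*}
    {vec : ∀ t, List L → (Option (B t) →₀ ℂ)} (hcons : ∀ t a u, vec t (a :: u) none = 0)
    (p : L → Bool) {w : List (T × L)} (hw : w ≠ []) :
    FreeAlgebra.algebraMapInv (runVector vec (runs p w)) = (0 : ℂ) := by
  have hr := isReduced_runs p w
  cases hm : runs p w with
  | nil =>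
    rcases w with _ | ⟨a, w⟩
    · exact absurd rfl hw
    · obtain ⟨r, h, -⟩ := exists_mem_runs (p := p) (List.mem_cons_self (a := a) (l := w))
      simp [hm] at h
  | cons r m =>
    obtain ⟨s, u⟩ := r
    rw [hm] at hr
    rcases u with _ | ⟨a, u⟩
    · exact absurd rfl (hr.1 _ List.mem_cons_self)
    · simp [runVector, algebraMapInv_letterEmb, hcons]

theorem moment_sum_of_isBiFree [Fintype T] {A : Type w} [Ring A] [Algebra ℂ A] {φ : A →ₗ[ℂ] ℂ}
    {z : T → I ⊕ J → A} (h : IsBiFree φ z) {κ : T → List (I ⊕ J) → ℂ}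
    (hκ : ∀ t m, moment (distribution φ (z t)) m = momentSeries Sum.isLeft (κ t) m.reverse [])
    (m : List (I ⊕ J)) :
    moment (distribution φ fun k => ∑ t, z t k) m =
      momentSeries Sum.isLeft (fun u => ∑ t, κ t u) m.reverse [] := by
  classical
  obtain ⟨B, S, h⟩ := h
  replace h : distribution φ (fun a : T × (I ⊕ J) => z a.1 a.2) =
    distribution (freeProductState B) (faceOp S) := h
  have hS : ∀ t (m : List (I ⊕ J)), Finsupp.lapply (R := ℂ) none ((m.map (S t)).prod
      (Finsupp.single none 1)) = momentSeries Sum.isLeft (κ t) m.reverse [] := fun t m => by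
    rw [← hκ, Finsupp.lapply_apply, ← distribution_faceOp_marginal, ← h, moment_distribution]
    simp [distribution, Function.comp_def]
  set vec : ∀ t, List (I ⊕ J) → (Option (B t) →₀ ℂ) := fun t =>
    queueVector Sum.isLeft (κ t) (S t) (Finsupp.single none 1) with hvec
  have hnil : ∀ t, vec t [] = Finsupp.single none 1 := fun t => by simp [hvec, queueVector]
  have hcons : ∀ t a u, vec t (a :: u) none = 0 := fun t a u => by
    have := queueVector_coeff _ _ (hS t) [] (a :: u)
    simpa [momentSeries] using this
  have hmodel := (isQueueModel_polyFaceOp hnil hcons Sum.isLeft S fun t =>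
    queueVector_isQueueModel _).labelSum
  have hJ : distribution (freeProductState B) (faceOp S) =
      (FreeAlgebra.algebraMapInv (R := ℂ)).toLinearMap ∘ₗ LinearMap.applyₗ 1 ∘ₗ
        (FreeAlgebra.lift ℂ (polyFaceOp Sum.isLeft S)).toLinearMap :=
    monomial_ext fun m => by
      rw [distribution_faceOp_monomial]
      simp
  -- Equality of distributions concerns polynomials in the separate variables, so the moment of the
  -- sum is written as the value at such a polynomial.
  set P : FreeAlgebra ℂ (T × (I ⊕ J)) :=
    (m.map fun k => ∑ t, FreeAlgebra.ι ℂ (t, k)).prod with hP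
  have h1 : moment (distribution φ fun k => ∑ t, z t k) m =
      distribution φ (fun a : T × (I ⊕ J) => z a.1 a.2) P := by
    rw [moment_distribution, distribution, LinearMap.comp_apply, AlgHom.toLinearMap_apply, hP,
      map_list_prod (FreeAlgebra.lift ℂ _), List.map_map]
    congr 3
    funext k
    simp
  have h2 : FreeAlgebra.lift ℂ (polyFaceOp Sum.isLeft S) P =
      (m.map fun k => ∑ t, polyFaceOp Sum.isLeft S (t, k)).prod := by
    rw [hP, map_list_prod, List.map_map]
    congr 2
    funext k
    simp
  have hv : labelSum (fun w => runVector vec (runs Sum.isLeft w)) [] = 1 := by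
    simp [labelSum, runs, runVector]
  have hf : ∀ x w, FreeAlgebra.algebraMapInv (labelSum (fun w => runVector vec
      (runs Sum.isLeft w)) (x :: w)) = (0 : ℂ) := fun x w => by
    refine (map_labelSum (FreeAlgebra.algebraMapInv (R := ℂ)).toAddMonoidHom _ _).trans ?_
    exact labelSum_cons_eq_zero _ (fun a x => algebraMapInv_runVector hcons _ (by simp)) _ _
  have h3 := hmodel.prod_apply (FreeAlgebra.algebraMapInv (R := ℂ)).toLinearMap
    (by rw [hv]; simp) hf m []
  rw [h1, h, hJ, ← h3, hv]
  simp [h2]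

end Additivity

/-! ### Realization of families of cumulants -/

section Realization

variable {L : Type u}

/-- The word which corresponds to a basis vector. -/
def wordOf : Option (L × List L) → List L
  | none => []
  | some a => a.1 :: a.2

/-- The basis vector which corresponds to a word. -/
noncomputable def wordVector : List L → (Option (L × List L) →₀ ℂ)
  | [] => Finsupp.single none 1
  | k :: w => Finsupp.single (some (k, w)) 1

/-- The operators with given cumulants. -/
noncomputable def modelOp (p : L → Bool) (κ : List L → ℂ) (k : L) :
    Module.End ℂ (Option (L × List L) →₀ ℂ) :=
  Finsupp.linearCombination ℂ fun x => wordVector (k :: wordOf x) +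
    ((cuts (fun x => p x == p k) (wordOf x)).map fun q =>
      κ (k :: q.1) • wordVector q.2).sum

theorem isQueueModel_modelOp (p : L → Bool) (κ : List L → ℂ) :
    IsQueueModel p κ (modelOp p κ) wordVector where
  apply k w := by
    cases w <;> simp [modelOp, wordVector, wordOf]

/-- On the free module over all words the recursion can be taken as the definition of the operators,
so no condition on `κ` is needed. -/
theorem exists_isBiFree {T : Type} {I J : Type u} (κ : T → List (I ⊕ J) → ℂ) :
    ∃ (A : Type u) (_ : Ring A) (_ : Algebra ℂ A) (φ : A →ₗ[ℂ] ℂ) (z : T → I ⊕ J → A),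
      φ 1 = 1 ∧ IsBiFree φ z ∧ ∀ t m,
        moment (distribution φ (z t)) m = momentSeries Sum.isLeft (κ t) m.reverse [] := by
  let B : T → Type u := fun _ => (I ⊕ J) × List (I ⊕ J)
  let S : ∀ t, I ⊕ J → Module.End ℂ (Option (B t) →₀ ℂ) := fun t => modelOp Sum.isLeft (κ t)
  refine ⟨Module.End ℂ (AltWord B →₀ ℂ), inferInstance, inferInstance, freeProductState B,
    fun t k => faceOp S (t, k), ?_, ⟨B, S, rfl⟩, fun t m => ?_⟩
  · rw [freeProductState_apply, Module.End.one_apply, altEmb_single]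
    simp [AltWord.nil]
  · have h := distribution_faceOp_marginal S t m
    rw [moment_distribution]
    have h2 := (isQueueModel_modelOp Sum.isLeft (κ t)).prod_apply (Finsupp.lapply none)
      (by simp [wordVector]) (fun x w => by simp [wordVector]) m []
    rw [← h2]
    refine Eq.trans ?_ h
    refine Eq.trans ?_ (moment_distribution _ _ _).symm
    simp [Function.comp_def]

end Realization

/-! ### The cumulant polynomials -/

section CumulantPolynomials

variable {L : Type*} (p : L → Bool)

/-- The cumulants as polynomials in the moments. -/
noncomputable def cumulantSeries (m : List L) : MvPolynomial (List L) ℂ :=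
  MvPolynomial.X m - momentSeries p
    (fun u => if _ : u.length < m.length then cumulantSeries u else 0) m.reverse []
termination_by m.length

theorem cumulantSeries_eq (m : List L) : cumulantSeries p m =
    MvPolynomial.X m - momentSeries p (truncate m.length (cumulantSeries p)) m.reverse [] := by
  rw [cumulantSeries]
  simp only [dite_eq_ite]
  rfl

theorem cumulantSeries_mem_supported (m : List L) (hm : m ≠ []) :
    cumulantSeries p m ∈ MvPolynomial.supported ℂ {x : List L | x ≠ [] ∧ x.Sublist m} := by
  induction hn : m.length using Nat.strong_induction_on generalizing m with
  | _ n ih =>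
    rw [cumulantSeries_eq]
    refine Subalgebra.sub_mem _ (MvPolynomial.X_mem_supported.2 ⟨hm, List.Sublist.refl m⟩)
      (momentSeries_mem _ _ _ _ fun u hu hs => ?_)
    rw [truncate]
    split_ifs with hl
    · rw [List.reverse_reverse, List.append_nil] at hs
      have hsub : {x : List L | x ≠ [] ∧ x.Sublist u} ⊆ {x | x ≠ [] ∧ x.Sublist m} :=
        fun x hx => ⟨hx.1, hx.2.trans hs⟩
      exact MvPolynomial.supported_mono hsub (ih _ (hn ▸ hl) u hu rfl)
    · exact Subalgebra.zero_mem _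

theorem exists_cumulantSeries_eq_X_add (m : List L) :
    ∃ R' : MvPolynomial (List L) ℂ, cumulantSeries p m = MvPolynomial.X m + R' ∧
      ∀ x ∈ R'.vars, x ≠ [] ∧ x.Sublist m ∧ x.length < m.length := by
  refine ⟨_, (cumulantSeries_eq p m).trans (sub_eq_add_neg _ _), ?_⟩
  set S : Set (List L) := {x | x ≠ [] ∧ x.Sublist m ∧ x.length < m.length}
  suffices h : -momentSeries p (truncate m.length (cumulantSeries p)) m.reverse [] ∈
      MvPolynomial.supported ℂ S from fun x hx => MvPolynomial.mem_supported.1 h hx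
  refine Subalgebra.neg_mem _ (momentSeries_mem _ _ _ _ fun u hu hs => ?_)
  rw [truncate]
  split_ifs with hl
  · rw [List.reverse_reverse, List.append_nil] at hs
    have hsub : {x : List L | x ≠ [] ∧ x.Sublist u} ⊆ S :=
      fun x hx => ⟨hx.1, hx.2.trans hs, hx.2.length_le.trans_lt hl⟩
    exact MvPolynomial.supported_mono hsub (cumulantSeries_mem_supported p u hu)
  · exact Subalgebra.zero_mem _

theorem isWeightedHomogeneous_cumulantSeries (m : List L) :
    MvPolynomial.IsWeightedHomogeneous List.length (cumulantSeries p m) m.length := by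
  induction hn : m.length using Nat.strong_induction_on generalizing m with
  | _ n ih =>
    rw [cumulantSeries_eq, hn]
    refine MvPolynomial.IsWeightedHomogeneous.sub
      (hn ▸ MvPolynomial.isWeightedHomogeneous_X ℂ List.length m) ?_
    have h : ∀ u, MvPolynomial.IsWeightedHomogeneous List.length
        (truncate n (cumulantSeries p) u) u.length := fun u => by
      rw [truncate]
      split_ifs with hl
      · exact ih _ hl u rfl
      · exact MvPolynomial.isWeightedHomogeneous_zero _ _ _
    simpa [hn] using momentSeries_isWeightedHomogeneous (p := p) h m.reverse []

theorem eval_momentSeries_truncate (x : List L → ℂ) (n : ℕ) (m w : List L) :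
    MvPolynomial.eval x (momentSeries p (truncate n (cumulantSeries p)) m w) =
      momentSeries p (truncate n fun u => MvPolynomial.eval x (cumulantSeries p u)) m w := by
  rw [map_momentSeries]
  congr 1
  funext u
  rw [truncate, truncate]
  split_ifs <;> simp

/-- By triangularity the moment of `m` minus its part in shorter cumulants is `κ m`. Together with
`momentSeries_eval_cumulantSeries` this makes the two transforms inverse to each other. -/
theorem eval_cumulantSeries (κ : List L → ℂ) (m : List L) (hm : m ≠ []) :
    MvPolynomial.eval (fun u => momentSeries p κ u.reverse []) (cumulantSeries p m) = κ m := by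
  induction hn : m.length using Nat.strong_induction_on generalizing m with
  | _ n ih =>
    rw [cumulantSeries_eq, map_sub, MvPolynomial.eval_X, eval_momentSeries_truncate,
      momentSeries_eq_add _ _ (by simpa using hm)]
    simp only [List.reverse_reverse, List.append_nil, List.length_reverse, List.length_nil,
      add_zero]
    refine sub_eq_of_eq_add (congrArg _ (momentSeries_congr _ _ fun u hu _ => ?_))
    rw [truncate, truncate]
    split_ifs with hl
    · exact (ih _ (hn ▸ hl) u hu rfl).symm
    · rfl

theorem momentSeries_eval_cumulantSeries (x : List L → ℂ) (hx : x [] = 1) (m : List L) :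
    momentSeries p (fun u => MvPolynomial.eval x (cumulantSeries p u)) m.reverse [] = x m := by
  by_cases hm : m = []
  · subst hm
    simp [momentSeries, hx]
  · rw [momentSeries_eq_add _ _ (by simpa using hm)]
    simp only [List.reverse_reverse, List.append_nil, List.length_reverse, List.length_nil,
      add_zero]
    rw [cumulantSeries_eq, map_sub, MvPolynomial.eval_X, eval_momentSeries_truncate]
    simp

end CumulantPolynomials

/-! ### Cumulant polynomials and central limit distributions -/

section CentralLimit

variable {I J : Type u}

theorem isCumulantPolynomial_cumulantSeries (m : List (I ⊕ J)) (hm : m ≠ []) :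
    IsCumulantPolynomial m (cumulantSeries Sum.isLeft m) where
  leading := exists_cumulantSeries_eq_X_add _ m
  homogeneous := isWeightedHomogeneous_cumulantSeries _ m
  additive A _ _ φ z h1 h := by
    set κ : Bool → List (I ⊕ J) → ℂ := fun t u =>
      MvPolynomial.eval (moment (distribution φ (z t))) (cumulantSeries Sum.isLeft u) with hκ
    have h2 := moment_sum_of_isBiFree h (κ := κ) fun t m =>
      (momentSeries_eval_cumulantSeries _ _ (by simp [moment, distribution, h1]) m).symm
    have h3 : moment (distribution φ fun k => z false k + z true k) =
        fun m => momentSeries Sum.isLeft (fun u => ∑ t, κ t u) m.reverse [] := by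
      funext m
      rw [← h2]
      congr 2
      funext k
      simp [add_comm]
    rw [h3, eval_cumulantSeries _ _ m hm]
    simp [hκ, add_comm]

/-- Existence suffices: the arguments below use the characterizing properties and never the
uniqueness of the polynomial. -/
theorem isCumulantPolynomial_cumulantPolynomial (m : List (I ⊕ J)) (hm : m ≠ []) :
    IsCumulantPolynomial m (cumulantPolynomial m) :=
  Classical.epsilon_spec ⟨_, isCumulantPolynomial_cumulantSeries m hm⟩

theorem eval_congr_of_forall_vars {σ : Type*} {x y : σ → ℂ} {P : MvPolynomial σ ℂ}
    (h : ∀ i ∈ P.vars, x i = y i) : MvPolynomial.eval x P = MvPolynomial.eval y P :=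
  MvPolynomial.eval₂Hom_congr' rfl (fun i hi _ => h i hi) rfl

/-- Central limit distributions are determined by their second order moments. -/
theorem IsCentralLimit.ext {μ ν : FreeAlgebra ℂ (I ⊕ J) →ₗ[ℂ] ℂ} (hμ : IsCentralLimit μ)
    (hν : IsCentralLimit ν) (h : ∀ a b, moment μ [a, b] = moment ν [a, b]) : μ = ν := by
  refine monomial_ext fun m => ?_
  change moment μ m = moment ν m
  induction hn : m.length using Nat.strong_induction_on generalizing m with
  | _ n ih =>
    by_cases h0 : m = []
    · subst h0
      simp [moment, hμ.1, hν.1]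
    by_cases h2 : m.length = 2
    · obtain ⟨a, b, rfl⟩ := List.length_eq_two.1 h2
      exact h a b
    · have hl : m.length = 1 ∨ 3 ≤ m.length := by
        have := List.length_pos_iff.2 h0
        omega
      -- Both cumulants vanish, and apart from the leading moment they involve shorter words only,
      -- where the functionals agree.
      obtain ⟨R', hR, hv⟩ := (isCumulantPolynomial_cumulantPolynomial m h0).leading
      have e := (hμ.2 m hl).trans (hν.2 m hl).symm
      rw [cumulant, cumulant, hR, map_add, map_add, MvPolynomial.eval_X, MvPolynomial.eval_X,
        eval_congr_of_forall_vars fun x hx => ih x.length (hn ▸ (hv x hx).2.2) x rfl] at e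
      exact add_right_cancel e

theorem eval_of_isWeightedHomogeneous {σ : Type*} {d : σ → ℕ} {n : ℕ} {P : MvPolynomial σ ℂ}
    (hP : MvPolynomial.IsWeightedHomogeneous d P n) (c : ℂ) (x : σ → ℂ) :
    MvPolynomial.eval (fun i => c ^ d i * x i) P = c ^ n * MvPolynomial.eval x P := by
  rw [MvPolynomial.eval_eq, MvPolynomial.eval_eq, Finset.mul_sum]
  refine Finset.sum_congr rfl fun s hs => ?_
  have h := hP (MvPolynomial.mem_support_iff.1 hs)
  simp only [mul_pow, Finset.prod_mul_distrib, ← pow_mul]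
  rw [Finset.prod_pow_eq_pow_sum]
  have : ∑ i ∈ s.support, d i * s i = n := by
    rw [← h, Finsupp.weight_apply, Finsupp.sum]
    exact Finset.sum_congr rfl fun i _ => by simp [mul_comm]
  rw [this]
  ring

/-- A functional whose moments are given by cumulants of order two. -/
theorem isCentralLimit_of_momentSeries {μ : FreeAlgebra ℂ (I ⊕ J) →ₗ[ℂ] ℂ}
    {κ : List (I ⊕ J) → ℂ} (hκ : ∀ u, u.length ≠ 2 → κ u = 0)
    (h : ∀ m, moment μ m = momentSeries Sum.isLeft κ m.reverse []) : IsCentralLimit μ := by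
  refine ⟨by simpa [moment, momentSeries] using h [], fun m hm => ?_⟩
  have hm0 : m ≠ [] := by
    rintro rfl
    simp at hm
  have hR := isCumulantPolynomial_cumulantPolynomial m hm0
  -- Two bi-free copies of `μ`; their sum will have the moments of `√2` times one copy.
  obtain ⟨A, _, _, φ, z, h1, hz, hmom⟩ := exists_isBiFree fun _ : Bool => κ
  have hμ : ∀ t, moment (distribution φ (z t)) = moment μ := fun t =>
    funext fun m => (hmom t m).trans (h m).symm
  have h2 := moment_sum_of_isBiFree hz hmom
  set c : ℂ := ((Real.sqrt 2 : ℝ) : ℂ) with hc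
  have hc2 : c ^ 2 = 2 := by
    rw [hc, ← Complex.ofReal_pow, Real.sq_sqrt (by norm_num)]
    norm_num
  have h3 : moment (distribution φ fun k => z false k + z true k) =
      fun m => c ^ m.length * moment μ m := by
    funext m
    rw [h m]
    have := momentSeries_scale (p := Sum.isLeft) c κ m.reverse []
    simp only [List.length_reverse, List.length_nil, add_zero] at this
    rw [← this]
    -- Doubling the cumulants is scaling by `√2` exactly because they live in order two.
    have e : (fun u => c ^ u.length * κ u) = fun u => ∑ _t : Bool, κ u := by
      funext u
      by_cases hu : u.length = 2
      · simp [hu, hc2]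
      · simp [hκ u hu]
    rw [e, ← h2]
    congr 2
    funext k
    simp [add_comm]
  have h4 := hR.additive A φ z h1 hz
  rw [h3, hμ, hμ, eval_of_isWeightedHomogeneous hR.homogeneous] at h4
  have h5 : c ^ m.length ≠ c ^ 2 := by
    rw [hc, ← Complex.ofReal_pow, ← Complex.ofReal_pow, Ne, Complex.ofReal_inj]
    intro he
    have := pow_right_injective₀ (a := Real.sqrt 2) (by positivity)
      (by simp) he
    omega
  rw [hc2] at h5
  have h6 : (c ^ m.length - 2) * cumulant μ m = 0 := by
    rw [cumulant]
    linear_combination -h4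
  exact (mul_eq_zero.1 h6).resolve_left (sub_ne_zero.2 h5)

theorem momentSeries_two {p : I ⊕ J → Bool} {κ : List (I ⊕ J) → ℂ} (hκ : ∀ a, κ [a] = 0)
    (a b : I ⊕ J) : momentSeries p κ [b, a] [] = κ [a, b] := by
  simp [momentSeries, cuts, hκ]

end CentralLimit

/-! ### Creation and annihilation operators -/

section FockOperators

variable {H : Type w} [NormedAddCommGroup H] [InnerProductSpace ℂ H]

theorem inner_completion_apply {E F : Type w} [NormedAddCommGroup E] [InnerProductSpace ℂ E]
    [NormedAddCommGroup F] [InnerProductSpace ℂ F] {f g : E →L[ℂ] F} {c : ℂ}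
    (h : ∀ x y, inner ℂ (f x) (g y) = c * inner ℂ x y) (x y : UniformSpace.Completion E) :
    inner ℂ (f.completion x) (g.completion y) = c * inner ℂ x y := by
  induction x, y using UniformSpace.Completion.induction_on₂ with
  | hp =>
    refine isClosed_eq ?_ ?_
    · exact Continuous.inner (f.completion.continuous.comp continuous_fst)
        (g.completion.continuous.comp continuous_snd)
    · exact continuous_const.mul (Continuous.inner continuous_fst continuous_snd)
  | ih a b =>
    rw [ContinuousLinearMap.completion_apply_coe, ContinuousLinearMap.completion_apply_coe,
      UniformSpace.Completion.inner_coe, UniformSpace.Completion.inner_coe, h]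

theorem shiftOp_apply_zero {E : ℕ → Type w} [∀ n, NormedAddCommGroup (E n)]
    [∀ n, InnerProductSpace ℂ (E n)] (f : ∀ n, E n →L[ℂ] E (n + 1)) (C : ℝ) (hC : 0 ≤ C)
    (hf : ∀ n x, ‖f n x‖ ≤ C * ‖x‖) (ζ : lp E 2) : shiftOp f C hC hf ζ 0 = 0 := rfl

theorem shiftOp_apply_succ {E : ℕ → Type w} [∀ n, NormedAddCommGroup (E n)]
    [∀ n, InnerProductSpace ℂ (E n)] (f : ∀ n, E n →L[ℂ] E (n + 1)) (C : ℝ) (hC : 0 ≤ C)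
    (hf : ∀ n x, ‖f n x‖ ≤ C * ‖x‖) (ζ : lp E 2) (n : ℕ) :
    shiftOp f C hC hf ζ (n + 1) = f n (ζ n) := rfl

/-- The component `0` of a shifted vector vanishes, so the series for the two inner products agree
after a shift of the index. -/
theorem inner_shiftOp_shiftOp {E : ℕ → Type w} [∀ n, NormedAddCommGroup (E n)]
    [∀ n, InnerProductSpace ℂ (E n)] {f g : ∀ n, E n →L[ℂ] E (n + 1)} {C D : ℝ} (hC : 0 ≤ C)
    (hD : 0 ≤ D) (hf : ∀ n x, ‖f n x‖ ≤ C * ‖x‖) (hg : ∀ n x, ‖g n x‖ ≤ D * ‖x‖) {c : ℂ}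
    (h : ∀ n x y, inner ℂ (f n x) (g n y) = c * inner ℂ x y) (ζ η : lp E 2) :
    inner ℂ (shiftOp f C hC hf ζ) (shiftOp g D hD hg η) = c * inner ℂ ζ η := by
  have h1 := (lp.hasSum_inner (𝕜 := ℂ) ζ η).mul_left c
  have h2 := lp.hasSum_inner (𝕜 := ℂ) (shiftOp f C hC hf ζ) (shiftOp g D hD hg η)
  rw [← hasSum_nat_add_iff' 1] at h2
  simp only [shiftOp_apply_succ, h, Finset.range_one, Finset.sum_singleton, shiftOp_apply_zero,
    inner_zero_left, sub_zero] at h2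
  exact h2.unique h1

theorem inner_leftTensor (g h : H) (n : ℕ) (x y : (tensorPower H n).carrier) :
    inner ℂ (leftTensor g n x) (leftTensor h n y) = inner ℂ g h * inner ℂ x y :=
  TensorProduct.inner_tmul _ _ _ _ _

theorem inner_lTensor_lTensor {E F : Type w} [NormedAddCommGroup E] [InnerProductSpace ℂ E]
    [NormedAddCommGroup F] [InnerProductSpace ℂ F] {f g : E →L[ℂ] F} {c : ℂ}
    (h : ∀ x y, inner ℂ (f x) (g y) = c * inner ℂ x y) (x y : H ⊗[ℂ] E) :
    inner ℂ (ContinuousLinearMap.lTensor H f x) (ContinuousLinearMap.lTensor H g y) =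
      c * inner ℂ x y := by
  induction x with
  | zero => simp
  | add x x' hx hx' => simp only [map_add, inner_add_left, hx, hx', mul_add]
  | tmul a b =>
    induction y with
    | zero => simp
    | add y y' hy hy' => simp only [map_add, inner_add_right, hy, hy', mul_add]
    | tmul a' b' =>
      simp [h]
      ring

theorem inner_rightTensor (g h : H) (n : ℕ) (x y : (tensorPower H n).carrier) :
    inner ℂ (rightTensor g n x) (rightTensor h n y) = inner ℂ g h * inner ℂ x y := by
  induction n with
  | zero => exact inner_leftTensor g h 0 x y
  | succ n ih => exact inner_lTensor_lTensor ih x y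

theorem inner_leftCreation (g h : H) (ζ η : Fock H) :
    inner ℂ (leftCreation g ζ) (leftCreation h η) = inner ℂ g h * inner ℂ ζ η :=
  inner_shiftOp_shiftOp _ _ _ _ (fun n => inner_completion_apply (inner_leftTensor g h n)) ζ η

theorem inner_rightCreation (g h : H) (ζ η : Fock H) :
    inner ℂ (rightCreation g ζ) (rightCreation h η) = inner ℂ g h * inner ℂ ζ η :=
  inner_shiftOp_shiftOp _ _ _ _ (fun n => inner_completion_apply (inner_rightTensor g h n)) ζ η

theorem adjoint_leftCreation_leftCreation (g h : H) (ζ : Fock H) :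
    ContinuousLinearMap.adjoint (leftCreation g) (leftCreation h ζ) = inner ℂ g h • ζ :=
  ext_inner_left ℂ fun η => by
    rw [ContinuousLinearMap.adjoint_inner_right, inner_leftCreation, inner_smul_right]

theorem adjoint_rightCreation_rightCreation (g h : H) (ζ : Fock H) :
    ContinuousLinearMap.adjoint (rightCreation g) (rightCreation h ζ) = inner ℂ g h • ζ :=
  ext_inner_left ℂ fun η => by
    rw [ContinuousLinearMap.adjoint_inner_right, inner_rightCreation, inner_smul_right]

theorem vacuum_apply_zero : vacuum H 0 = (unitVector H : HilbertPower H 0) :=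
  lp.single_apply_self _ _ _

theorem vacuum_apply_succ (n : ℕ) : vacuum H (n + 1) = 0 :=
  lp.single_apply_ne _ _ _ (by simp)

theorem inner_vacuum (ζ : Fock H) :
    inner ℂ ζ (vacuum H) = inner ℂ (ζ 0) (unitVector H : HilbertPower H 0) := by
  rw [vacuum, lp.inner_single_right]

theorem inner_vacuum_vacuum : inner ℂ (vacuum H) (vacuum H) = 1 := by
  rw [inner_vacuum, vacuum_apply_zero, UniformSpace.Completion.inner_coe]
  change inner ℂ (EuclideanSpace.single PUnit.unit (1 : ℂ) : EuclideanSpace ℂ PUnit.{w + 1})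
    (EuclideanSpace.single PUnit.unit (1 : ℂ)) = (1 : ℂ)
  simp

theorem adjoint_leftCreation_vacuum (g : H) :
    ContinuousLinearMap.adjoint (leftCreation g) (vacuum H) = 0 :=
  ext_inner_left ℂ fun η => by
    rw [ContinuousLinearMap.adjoint_inner_right, inner_vacuum, leftCreation, shiftOp_apply_zero,
      inner_zero_left, inner_zero_right]

theorem adjoint_rightCreation_vacuum (g : H) :
    ContinuousLinearMap.adjoint (rightCreation g) (vacuum H) = 0 :=
  ext_inner_left ℂ fun η => by
    rw [ContinuousLinearMap.adjoint_inner_right, inner_vacuum, rightCreation, shiftOp_apply_zero,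
      inner_zero_left, inner_zero_right]

theorem rightCreation_vacuum (h : H) : rightCreation h (vacuum H) = leftCreation h (vacuum H) := by
  refine lp.ext (funext fun n => ?_)
  rcases n with _ | _ | n
  · rfl
  · rfl
  · rw [rightCreation, leftCreation, shiftOp_apply_succ, shiftOp_apply_succ, vacuum_apply_succ,
      map_zero, map_zero]

theorem completion_apply_comm {E F G F' : Type w} [NormedAddCommGroup E] [InnerProductSpace ℂ E]
    [NormedAddCommGroup F] [InnerProductSpace ℂ F] [NormedAddCommGroup G] [InnerProductSpace ℂ G]
    [NormedAddCommGroup F'] [InnerProductSpace ℂ F']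
    {f : E →L[ℂ] F} {g : F →L[ℂ] G} {f' : E →L[ℂ] F'} {g' : F' →L[ℂ] G}
    (h : ∀ x, g (f x) = g' (f' x)) (x : UniformSpace.Completion E) :
    g.completion (f.completion x) = g'.completion (f'.completion x) := by
  induction x using UniformSpace.Completion.induction_on with
  | hp => exact isClosed_eq (by fun_prop) (by fun_prop)
  | ih a => simp only [ContinuousLinearMap.completion_apply_coe, h]

theorem rightCreation_leftCreation (g h : H) (ζ : Fock H) :
    rightCreation g (leftCreation h ζ) = leftCreation h (rightCreation g ζ) := by
  refine lp.ext (funext fun n => ?_)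
  rcases n with _ | _ | n
  · rfl
  · rw [rightCreation, leftCreation, shiftOp_apply_succ, shiftOp_apply_succ, shiftOp_apply_zero,
      shiftOp_apply_zero, map_zero, map_zero]
  · rw [rightCreation, leftCreation, shiftOp_apply_succ, shiftOp_apply_succ, shiftOp_apply_succ,
      shiftOp_apply_succ]
    -- On `h ⊗ x` the right tensor acts inside the second factor by definition; this includes the
    -- power `0`.
    exact completion_apply_comm (f := leftTensor h n) (g := rightTensor g (n + 1))
      (f' := rightTensor g n) (g' := leftTensor h (n + 1)) (fun x => rfl) _

/-- The elementary tensor of a list of vectors. -/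
noncomputable def fockVector : List H → Fock H
  | [] => vacuum H
  | h :: d => leftCreation h (fockVector d)

theorem rightCreation_fockVector (h : H) (d : List H) :
    rightCreation h (fockVector d) = fockVector (d ++ [h]) := by
  induction d with
  | nil => exact rightCreation_vacuum h
  | cons g d ih =>
    rw [fockVector, rightCreation_leftCreation, ih]
    rfl

theorem inner_vacuum_fockVector_cons (h : H) (d : List H) :
    inner ℂ (vacuum H) (fockVector (h :: d)) = 0 := by
  rw [fockVector, ← ContinuousLinearMap.adjoint_inner_left, adjoint_leftCreation_vacuum,
    inner_zero_left]

end FockOperators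

/-! ### The involution on polynomials -/

section AdjointPoly

variable {I J : Type u}

theorem adjointPoly_eq_sum_repr (P : StarPoly I J) : adjointPoly P =
    ((monomialBasis (StarIndex I J)).repr P).sum fun m c =>
      (starRingEnd ℂ c) • monomial (m.reverse.map swapStar) := by
  rw [adjointPoly, monomialBasis, Module.Basis.repr_reindex,
    Finsupp.sum_mapDomain_index_inj (Equiv.injective _)]
  rfl

theorem adjointPoly_add (P Q : StarPoly I J) :
    adjointPoly (P + Q) = adjointPoly P + adjointPoly Q := by
  simp only [adjointPoly_eq_sum_repr, map_add]
  exact Finsupp.sum_add_index' (by simp) fun m c d => by rw [map_add, add_smul]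

theorem adjointPoly_smul (c : ℂ) (P : StarPoly I J) :
    adjointPoly (c • P) = (starRingEnd ℂ c) • adjointPoly P := by
  simp only [adjointPoly_eq_sum_repr, map_smul]
  rw [Finsupp.sum_smul_index' (by simp), Finsupp.smul_sum]
  simp [mul_smul]

theorem adjointPoly_monomial (m : List (StarIndex I J)) :
    adjointPoly (monomial m) = monomial (m.reverse.map swapStar) := by
  rw [adjointPoly_eq_sum_repr, ← monomialBasis_apply, Module.Basis.repr_self,
    Finsupp.sum_single_index (by simp)]
  simp

/-- The conjugate-linear map `P ↦ P^*`. -/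
noncomputable def adjointPolyₗ : StarPoly I J →ₗ⋆[ℂ] StarPoly I J where
  toFun := adjointPoly
  map_add' := adjointPoly_add
  map_smul' := adjointPoly_smul

theorem star_prod_map {L A : Type*} [Ring A] [StarRing A] (z : L → A) (m : List L) :
    star (m.map z).prod = (m.reverse.map fun k => star (z k)).prod := by
  induction m with
  | nil => simp
  | cons k m ih => simp [ih]

theorem lift_adjointPoly {A : Type*} [Ring A] [StarRing A] [Algebra ℂ A] [StarModule ℂ A]
    (z : StarIndex I J → A) (hz : ∀ a, z (swapStar a) = star (z a)) (P : StarPoly I J) :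
    FreeAlgebra.lift ℂ z (adjointPoly P) = star (FreeAlgebra.lift ℂ z P) := by
  have hP : P ∈ Submodule.span ℂ (Set.range (monomialBasis (StarIndex I J))) := by simp
  induction hP using Submodule.span_induction with
  | zero => 
    exact (congrArg (FreeAlgebra.lift ℂ z) (map_zero (adjointPolyₗ (I := I) (J := J)))).trans
      (by simp)
  | add P Q _ _ hP hQ => rw [adjointPoly_add, map_add, hP, hQ, map_add, star_add]
  | smul c P _ hP =>
    rw [adjointPoly_smul, map_smul, hP, map_smul, star_smul]
    rfl
  | mem P hP =>
    obtain ⟨m, rfl⟩ := hP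
    rw [monomialBasis_apply, adjointPoly_monomial, lift_monomial, lift_monomial, star_prod_map,
      List.map_map]
    congr 2
    funext a
    exact hz a

end AdjointPoly

/-! ### The Fock space distribution -/

section FockDistribution

variable {I J : Type u} {H : Type w} [NormedAddCommGroup H] [InnerProductSpace ℂ H]

/-- The vectors created by the letters. -/
def created (h hs : I ⊕ J → H) : StarIndex I J → H :=
  Sum.elim (Sum.elim (fun i => h (Sum.inl i)) fun i => hs (Sum.inl i))
    (Sum.elim (fun j => h (Sum.inr j)) fun j => hs (Sum.inr j))

/-- The cumulants of order two of the Fock space distribution. -/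
noncomputable def fockCumulants (h hs : I ⊕ J → H) : List (StarIndex I J) → ℂ
  | [a, b] => inner ℂ (created hs h a) (created h hs b)
  | _ => 0

/-- The operator of a letter. -/
noncomputable def fockOp (h hs : I ⊕ J → H) (a : StarIndex I J) : Fock H →L[ℂ] Fock H :=
  if a.isLeft then leftCreation (created h hs a) +
      ContinuousLinearMap.adjoint (leftCreation (created hs h a))
    else rightCreation (created h hs a) +
      ContinuousLinearMap.adjoint (rightCreation (created hs h a))

theorem fockDistribution_eq (h hs : I ⊕ J → H) :
    fockDistribution h hs = distribution (vacuumState H) (fockOp h hs) := by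
  rw [fockDistribution, starDistribution]
  congr 1
  funext a
  rcases a with (i | i) | (j | j) <;>
    simp [fockFamily, fockOp, created, ContinuousLinearMap.star_eq_adjoint, add_comm]

theorem fockOp_swapStar (h hs : I ⊕ J → H) (a : StarIndex I J) :
    fockOp h hs (swapStar a) = star (fockOp h hs a) := by
  rcases a with (i | i) | (j | j) <;>
    simp [fockOp, created, swapStar, ContinuousLinearMap.star_eq_adjoint, add_comm]

theorem fockCumulants_of_length_ne {h hs : I ⊕ J → H} {u : List (StarIndex I J)}
    (hu : u.length ≠ 2) : fockCumulants h hs u = 0 := by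
  rcases u with _ | ⟨a, _ | ⟨b, _ | ⟨c, u⟩⟩⟩
  · rfl
  · rfl
  · simp at hu
  · rfl

/-- Annihilation removes the outermost tensor factor at its side, which is the cut with a one-letter
first segment; at the vacuum it gives zero, as there is no such cut. Exchanging the arguments in
`created hs h a` gives the vector that the adjoint letter creates. -/
theorem isQueueModel_fockOp (h hs : I ⊕ J → H) :
    IsQueueModel Sum.isLeft (fockCumulants h hs)
      (fun a => (fockOp h hs a : Fock H →ₗ[ℂ] Fock H))
      fun w => fockVector ((queue Sum.isLeft w).map (created h hs)) where
  apply a w := by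
    rw [ContinuousLinearMap.coe_coe, fockOp]
    by_cases ha : a.isLeft
    · have h1 := sum_cuts_singleton Sum.isLeft w (fun u d => fockCumulants h hs (a :: u) •
        fockVector (d.map (created h hs))) fun u v hu => by
          rw [fockCumulants_of_length_ne (by simpa using hu), zero_smul]
      simp only [ha, beq_true, if_true]
      rw [h1, queue, if_pos ha, add_apply]
      congr 1
      cases queue Sum.isLeft w with
      | nil => exact adjoint_leftCreation_vacuum _
      | cons x d => exact adjoint_leftCreation_leftCreation _ _ _
    -- Seen from the right the queue is reversed, and its first letter is the last tensor factor.
    · have h1 := sum_cuts_singleton (fun x => !Sum.isLeft x) w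
        (fun u d => fockCumulants h hs (a :: u) •
          fockVector (d.reverse.map (created h hs))) fun u v hu => by
            rw [fockCumulants_of_length_ne (by simpa using hu), zero_smul]
      simp only [queue_not, List.reverse_reverse] at h1
      simp only [Bool.not_eq_true] at ha
      simp only [ha, beq_false]
      rw [h1, queue, if_neg Bool.false_ne_true, if_neg (by rw [ha]; exact Bool.false_ne_true),
        add_apply,
        rightCreation_fockVector, List.map_append]
      congr 1
      rcases List.eq_nil_or_concat (queue Sum.isLeft w) with hq | ⟨d, x, hq⟩
      · rw [hq]
        exact adjoint_rightCreation_vacuum _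
      · rw [hq, List.concat_eq_append, List.map_append, List.reverse_append]
        simp only [List.map_cons, List.map_nil, List.reverse_singleton, List.singleton_append,
          List.reverse_reverse]
        rw [← rightCreation_fockVector, adjoint_rightCreation_rightCreation]
        rfl

theorem moment_fockDistribution (h hs : I ⊕ J → H) (m : List (StarIndex I J)) :
    moment (fockDistribution h hs) m =
      momentSeries Sum.isLeft (fockCumulants h hs) m.reverse [] := by
  have h2 : ∀ x : Fock H, (m.map (fockOp h hs)).prod x =
      (m.map fun a => (fockOp h hs a : Fock H →ₗ[ℂ] Fock H)).prod x := fun x => by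
    induction m with
    | nil => rfl
    | cons a m ih => simp [ih]
  have h1 := (isQueueModel_fockOp h hs).prod_apply (innerₛₗ ℂ (vacuum H))
    inner_vacuum_vacuum (fun x w => by
      cases hq : (queue Sum.isLeft (x :: w)).map (created h hs) with
      | nil => simp [queue_eq_nil] at hq
      | cons y d => exact inner_vacuum_fockVector_cons _ _) m []
  rw [← h1, fockDistribution_eq, moment_distribution]
  exact congrArg (inner ℂ (vacuum H)) (h2 _)

theorem isCentralLimit_fockDistribution (h hs : I ⊕ J → H) :
    IsCentralLimit (fockDistribution h hs) :=
  isCentralLimit_of_momentSeries (fun _ => fockCumulants_of_length_ne)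
    (moment_fockDistribution h hs)

theorem fockDistribution_adjointPoly_mul_nonneg (h hs : I ⊕ J → H) (P : StarPoly I J) :
    0 ≤ fockDistribution h hs (adjointPoly P * P) := by
  rw [fockDistribution_eq, distribution, LinearMap.comp_apply, AlgHom.toLinearMap_apply, map_mul,
    lift_adjointPoly _ (fockOp_swapStar h hs)]
  set S := FreeAlgebra.lift ℂ (fockOp h hs) P
  change 0 ≤ inner ℂ (vacuum H) (ContinuousLinearMap.adjoint S (S (vacuum H)))
  rw [ContinuousLinearMap.adjoint_inner_right, inner_self_eq_norm_sq_to_K]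
  have := Complex.zero_le_real.2 (sq_nonneg ‖S (vacuum H)‖)
  rwa [Complex.ofReal_pow] at this

theorem isCentralLimitStar_fockDistribution (h hs : I ⊕ J → H) :
    IsCentralLimitStar (fockDistribution h hs) :=
  ⟨isCentralLimit_fockDistribution h hs, fockDistribution_adjointPoly_mul_nonneg h hs⟩

theorem moment_pair (μ : StarPoly I J →ₗ[ℂ] ℂ) (a b : StarIndex I J) :
    moment μ [a, b] = μ (FreeAlgebra.ι ℂ a * FreeAlgebra.ι ℂ b) := by
  simp [moment]

theorem secondMoments_fockDistribution (h hs : I ⊕ J → H) :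
    secondMoments (fockDistribution h hs) = gramBlocks h hs := by
  have key : ∀ a b, fockDistribution h hs (FreeAlgebra.ι ℂ a * FreeAlgebra.ι ℂ b) =
      inner ℂ (created hs h a) (created h hs b) := fun a b => by
    rw [← moment_pair, moment_fockDistribution]
    exact momentSeries_two (fun _ => rfl) a b
  have hp : ∀ (f g : I ⊕ J → H) k, created f g (plain k) = f k := fun f g k => by
    cases k <;> rfl
  have hst : ∀ (f g : I ⊕ J → H) k, created f g (starred k) = g k := fun f g k => by
    cases k <;> rfl
  ext i j
  rcases i with k | k <;> rcases j with l | l <;>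
    simp [secondMoments, gramBlocks, Z, Zs, key, hp, hst]

theorem moment_pair_eq_of_secondMoments_eq {μ ν : StarPoly I J →ₗ[ℂ] ℂ}
    (h : secondMoments μ = secondMoments ν) (a b : StarIndex I J) :
    moment μ [a, b] = moment ν [a, b] := by
  have hcases : ∀ a : StarIndex I J, (∃ k, a = plain k) ∨ ∃ k, a = starred k := fun a => by
    rcases a with (i | i) | (j | j)
    · exact Or.inl ⟨Sum.inl i, rfl⟩
    · exact Or.inr ⟨Sum.inl i, rfl⟩
    · exact Or.inl ⟨Sum.inr j, rfl⟩
    · exact Or.inr ⟨Sum.inr j, rfl⟩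
  rw [moment_pair, moment_pair]
  rcases hcases a with ⟨k, rfl⟩ | ⟨k, rfl⟩ <;> rcases hcases b with ⟨l, rfl⟩ | ⟨l, rfl⟩
  · exact congrFun (congrFun h (Sum.inr k)) (Sum.inl l)
  · exact congrFun (congrFun h (Sum.inr k)) (Sum.inr l)
  · exact congrFun (congrFun h (Sum.inl k)) (Sum.inl l)
  · exact congrFun (congrFun h (Sum.inl k)) (Sum.inr l)

theorem eq_fockDistribution {φ : StarPoly I J →ₗ[ℂ] ℂ} (hφ : IsCentralLimit φ)
    {h hs : I ⊕ J → H} (hC : secondMoments φ = gramBlocks h hs) : φ = fockDistribution h hs :=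
  hφ.ext (isCentralLimit_fockDistribution h hs)
    (moment_pair_eq_of_secondMoments_eq (hC.trans (secondMoments_fockDistribution h hs).symm))

end FockDistribution

/-! ### Positivity and the matrix of second order moments -/

section Positivity

/-- A positive semidefinite matrix is a Gram matrix. -/
theorem exists_gram_eq {X : Type u} {C : Matrix X X ℂ} (hC : C.PosSemidef) :
    ∃ (H : Type u) (_ : NormedAddCommGroup H) (_ : InnerProductSpace ℂ H) (v : X → H),
      ∀ x y, inner ℂ (v x) (v y) = C x y := by
  let c : PreInnerProductSpace.Core ℂ (X →₀ ℂ) :=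
    { inner f g := f.sum fun x a => g.sum fun y b => star a * C x y * b
      conj_inner_symm f g := by
        rw [Finsupp.sum_comm]
        simp only [Finsupp.sum, map_sum]
        refine Finset.sum_congr rfl fun x _ => Finset.sum_congr rfl fun y _ => ?_
        rw [← hC.1.apply x y]
        simp only [map_mul, starRingEnd_apply, star_star]
        ring
      add_left f g h := by
        refine Finsupp.sum_add_index' (by simp) fun x a b => ?_
        rw [← Finsupp.sum_add]
        simp only [star_add, add_mul]
      smul_left f g r := by
        rw [Finsupp.sum_smul_index' (by simp), Finsupp.mul_sum]
        refine Finsupp.sum_congr fun x _ => ?_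
        rw [Finsupp.mul_sum]
        refine Finsupp.sum_congr fun y _ => ?_
        simp only [smul_eq_mul, star_mul', starRingEnd_apply]
        ring
      re_inner_nonneg f := (Complex.le_def.1 (hC.2 f)).1 }
  let _ := @InnerProductSpace.Core.toSeminormedAddCommGroup ℂ (X →₀ ℂ) _ _ _ c
  let _ : InnerProductSpace ℂ (X →₀ ℂ) := InnerProductSpace.ofCore c
  -- Null vectors are divided out. Completeness is not needed, because the Fock space completes the
  -- tensor powers itself.
  refine ⟨SeparationQuotient (X →₀ ℂ), inferInstance, inferInstance,
    fun x => SeparationQuotient.mk (Finsupp.single x 1), fun x y => ?_⟩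
  rw [SeparationQuotient.inner_mk_mk]
  change ((Finsupp.single x (1 : ℂ)).sum fun x a => (Finsupp.single y (1 : ℂ)).sum fun y b =>
    star a * C x y * b) = _
  simp

variable {I J : Type u}

/-- The letter of an index of the matrix of second order moments. -/
noncomputable def letter : (I ⊕ J) ⊕ (I ⊕ J) → StarPoly I J := Sum.elim Z Zs

theorem secondMoments_apply (φ : StarPoly I J →ₗ[ℂ] ℂ) (i j : (I ⊕ J) ⊕ (I ⊕ J)) :
    secondMoments φ i j = φ (adjointPoly (letter i) * letter j) := by
  have h : ∀ a : StarIndex I J,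
      adjointPoly (FreeAlgebra.ι ℂ a) = FreeAlgebra.ι ℂ (swapStar a) := fun a => by
    simpa using adjointPoly_monomial [a]
  have h1 : ∀ k : I ⊕ J, swapStar (plain k) = starred k := fun k => by cases k <;> rfl
  have h2 : ∀ k : I ⊕ J, swapStar (starred k) = plain k := fun k => by cases k <;> rfl
  rcases i with k | k <;> rcases j with l | l <;>
    simp [secondMoments, letter, Z, Zs, h, h1, h2]

/-- The quadratic form of the matrix is `φ (P^* P)` for linear combinations `P` of the letters. -/
theorem posSemidef_secondMoments {φ : StarPoly I J →ₗ[ℂ] ℂ}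
    (hφ : ∀ P : StarPoly I J, 0 ≤ φ (adjointPoly P * P)) : (secondMoments φ).PosSemidef := by
  constructor
  · refine Matrix.IsHermitian.ext fun i j => ?_
    -- Hermitian symmetry comes from polarization: `φ (P^* P)` is real for `P = letter j + c •
    -- letter i`, with `c = 1` for the imaginary parts and `c = I` for the real parts.
    have hQ : ∀ c : ℂ, (φ (adjointPoly (letter j + c • letter i) *
        (letter j + c • letter i))).im = 0 := fun c => (Complex.le_def.1 (hφ _)).2.symm
    have hi := (Complex.le_def.1 (hφ (letter i))).2
    have hj := (Complex.le_def.1 (hφ (letter j))).2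
    rw [← secondMoments_apply] at hi hj
    simp only [adjointPoly_add, adjointPoly_smul, add_mul, mul_add, smul_mul_assoc,
      mul_smul_comm, map_add, map_smul, ← secondMoments_apply, smul_eq_mul] at hQ
    have h1 := hQ 1
    have h2 := hQ Complex.I
    simp at h1 h2 hi hj
    apply Complex.ext
    · simp
      linarith
    · simp
      linarith
  · intro x
    have h := hφ (x.sum fun i c => c • letter i)
    have e : φ (adjointPoly (x.sum fun i c => c • letter i) * x.sum fun i c => c • letter i) =
        x.sum fun i xi => x.sum fun j xj => star xi * secondMoments φ i j * xj := by
      have : adjointPoly (x.sum fun i c => c • letter i) =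
          x.sum fun i c => (starRingEnd ℂ c) • adjointPoly (letter i) := by
        refine (map_finsuppSum (adjointPolyₗ (I := I) (J := J)) _ _).trans ?_
        exact Finsupp.sum_congr fun i _ => adjointPoly_smul _ _
      rw [this, Finsupp.sum_mul, map_finsuppSum]
      refine Finsupp.sum_congr fun i _ => ?_
      rw [Finsupp.mul_sum, map_finsuppSum]
      refine Finsupp.sum_congr fun j _ => ?_
      rw [secondMoments_apply]
      simp only [smul_mul_assoc, mul_smul_comm, map_smul, smul_eq_mul, starRingEnd_apply]
      ring
    exact e ▸ h

theorem IsCentralLimit.isCentralLimitStar_iff {φ : StarPoly I J →ₗ[ℂ] ℂ} (hφ : IsCentralLimit φ) :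
    IsCentralLimitStar φ ↔ (secondMoments φ).PosSemidef := by
  refine ⟨fun h => posSemidef_secondMoments h.2, fun h => ?_⟩
  obtain ⟨H, _, _, v, hv⟩ := exists_gram_eq h
  have hC : secondMoments φ = gramBlocks (fun k => v (Sum.inl k)) fun k => v (Sum.inr k) := by
    ext i j
    rw [← hv]
    rcases i with k | k <;> rcases j with l | l <;> rfl
  rw [eq_fockDistribution hφ hC]
  exact isCentralLimitStar_fockDistribution _ _

end Positivity

end BiFree

theorem theorem7p6 {I J : Type u} :
    (∀ φ : BiFree.StarPoly I J →ₗ[ℂ] ℂ, BiFree.IsCentralLimit φ →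
      (BiFree.IsCentralLimitStar φ ↔ (BiFree.secondMoments φ).PosSemidef)) ∧
    (Finite I → Finite J →
      ∀ (H : Type w) [NormedAddCommGroup H] [InnerProductSpace ℂ H] [CompleteSpace H]
        (h hs : I ⊕ J → H),
        BiFree.IsCentralLimitStar (BiFree.fockDistribution h hs) ∧
        BiFree.secondMoments (BiFree.fockDistribution h hs) = BiFree.gramBlocks h hs ∧
        ∀ φ : BiFree.StarPoly I J →ₗ[ℂ] ℂ, BiFree.IsCentralLimit φ →
          BiFree.secondMoments φ = BiFree.gramBlocks h hs →
          φ = BiFree.fockDistribution h hs) :=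
  ⟨fun _ hφ => hφ.isCentralLimitStar_iff, fun _ _ _ _ _ _ h hs =>
    ⟨BiFree.isCentralLimitStar_fockDistribution h hs, BiFree.secondMoments_fockDistribution h hs,
      fun _ hφ hC => BiFree.eq_fockDistribution hφ hC⟩⟩
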